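/- Let $\mathbb F_q$ be a finite field and $E: y^2+c_1ty+c_3y=t^3+c_2t^2+c_4t+c_6$ an elliptic curve over $\mathbb F_q$ with point at infinity $\infty$. Let $\mathbf A=\mathbb F_q[t,y]$ be its affine coordinate ring, $K$ an isomorphic copy of the fraction field of $\mathbf A$ in which $t,y$ are written $\theta,\eta$, $\iota:\mathbf A\to K$ the embedding with $\iota(t)=\theta$, $\iota(y)=\eta$, and $\Xi=(\theta,\eta)\in E(K)$. Let $H\supseteq K$ be a field and $V=(\alpha,\beta)\in E(H)$ a point with $V-V^{(1)}=\Xi$ (for instance $H=K(\alpha,\beta)$). Here $^{(1)}$ is the $q$-power Frobenius on points and on matrices over $H$, and on $H(t,y)$ (the function field of $E$ over $H$) it raises the coefficients in $H$ to the $q$-th power and fixes $t$ and $y$. The sign $\widetilde{\mathrm{sgn}}$ of a nonzero element of $H[t,y]$ is the coefficient of its leading term in the basis $t^i,\,t^iy$ ordered by pole order at $\infty$ ($2i$ and $2i+3$ respectively); it is extended multiplicatively to $H(t,y)^\times$. Let $n\ge 2$, and assume that $[j]V^{(1)}+[n-j]V\ne\infty$ for $1\le j\le n-1$. Then there is a unique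 $f\in H(t,y)$ with $\widetilde{\mathrm{sgn}}(f)=1$ and divisor $(V^{(1)})-(V)+(\Xi)-(\infty)$, and there are unique $g_1,\dots,g_n\in H(t,y)$ with $\widetilde{\mathrm{sgn}}(g_j)=1$ and $$\mathrm{div}(g_j)=-n(V)+(n-j)(\infty)+(j-1)(\Xi)+([j-1]V^{(1)}+[n-(j-1)]V).$$ Put $\tau h=f^nh^{(1)}$ for $h\in H(t,y)$ and $g_{kn+j}=\tau^k g_j$ for $k\ge 0$, $1\le j\le n$. There are unique constants $a_i,y_i,z_i\in H$ $(1\le i\le n)$ with $$tg_i=\theta g_i+a_ig_{i+1}+g_{i+2},\qquad yg_i=\eta g_i+y_ig_{i+1}+z_ig_{i+2}+g_{i+3}.$$ In the ring $\mathrm{Mat}_n(H)[\tau]$ of twisted polynomials ($\tau M=M^{(1)}\tau$) put $$\rho^{\otimes n}_t=d[\theta]+E_\theta\tau,\qquad \rho^{\otimes n}_y=d[\eta]+E_\eta\tau+E'_\eta\tau^2.$$ Here $d[\theta]$ has entries $\theta$ at $(i,i)$, $a_i$ at $(i,i+1)$ and $1$ at $(i,i+2)$; $E_\theta$ has $a_n$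 at $(n,1)$ and $1$ at $(n-1,1)$ and $(n,2)$; $d[\eta]$ has $\eta$ at $(i,i)$, $y_i$ at $(i,i+1)$, $z_i$ at $(i,i+2)$ and $1$ at $(i,i+3)$; $E_\eta$ has $y_n$ at $(n,1)$, $z_{n-1}$ at $(n-1,1)$, $z_n$ at $(n,2)$ and $1$ at those of $(n-2,1),(n-1,2),(n,3)$ that are positions of an $n\times n$ matrix. All other entries are $0$. The matrix $E'_\eta$ is $0$ for $n\ge 3$; for $n=2$ its only nonzero entry is $1$ at $(2,1)$. Then there is a unique $\mathbb F_q$-algebra homomorphism $\rho^{\otimes n}:\mathbf A\to\mathrm{Mat}_n(H)[\tau]$, $a\mapsto\rho_a^{\otimes n}$, taking these values at $t$ and $y$. It is an $n$-dimensional Anderson $\mathbf A$-module: for every $a\in\mathbf A$ the coefficient $d[a]$ of $\tau^0$ in $\rho^{\otimes n}_a$ is $\iota(a)I+N$ with $N$ nilpotent. -/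

import Mathlib

open Polynomial
open scoped nonZeroDivisors Polynomial.Bivariate WeierstrassCurve

namespace AndersonTensor

noncomputable section

/-! ### Functions on a Weierstrass curve over a field: order and leading coefficient at infinity -/

section Functions

variable {H : Type*} [Field H] (E : WeierstrassCurve.Affine H)

/-- The coordinate functions `t` and `y` of the curve. -/
def tCoord : E.CoordinateRing :=
  WeierstrassCurve.Affine.CoordinateRing.mk E (C X)

/-- See `tCoord`. -/
def yCoord : E.CoordinateRing :=
  WeierstrassCurve.Affine.CoordinateRing.mk E Y

variable {E}

/-- The pole order at infinity of a nonzero regular function `p(t) + q(t) y`. It equals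
`max (2 deg p) (2 deg q + 3)`, so that `t` has order `2` and `y` has order `3`. -/
def poleOrder (a : E.CoordinateRing) : ℕ :=
  (Algebra.norm H[X] a).natDegree

/-- The coefficient of the leading term of `p(t) + q(t) y`, the monomials `t ^ i` and `t ^ i y`
being ordered by their (pairwise distinct) pole orders `2 i` and `2 i + 3` at infinity. -/
def leadCoeff (a : E.CoordinateRing) : H :=
  let p := (WeierstrassCurve.Affine.CoordinateRing.basis E).repr a 0
  let q := (WeierstrassCurve.Affine.CoordinateRing.basis E).repr a 1
  if 2 • q.degree + 3 < 2 • p.degree then p.leadingCoeff else q.leadingCoeff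

/-- The rational function `g` is nonzero, has pole order `d` at infinity, and its sign (the
multiplicative extension of `leadCoeff` to the function field) is `c`. -/
def HasLeadingTerm (g : E.FunctionField) (d : ℤ) (c : H) : Prop :=
  ∃ a b : E.CoordinateRing, a ≠ 0 ∧ b ≠ 0 ∧
    g * algebraMap E.CoordinateRing E.FunctionField b
      = algebraMap E.CoordinateRing E.FunctionField a ∧
    (poleOrder a : ℤ) - poleOrder b = d ∧ leadCoeff a = c * leadCoeff b

/-- The sign of `g` is `1`. -/
def HasSignOne (g : E.FunctionField) : Prop :=
  ∃ d : ℤ, HasLeadingTerm g d 1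

/-- The ideal of functions vanishing at a rational point, as an invertible fractional ideal of the
coordinate ring; the point at infinity does not lie on the affine curve and gives the unit ideal. -/
def pointIdeal : E.Point → (FractionalIdeal E.CoordinateRing⁰ E.FunctionField)ˣ
  | .zero => 1
  | .some _ _ h => WeierstrassCurve.Affine.CoordinateRing.XYIdeal' (W := E) h

/-- The rational function `g` is nonzero with divisor `D` (a divisor supported at rational
points): on the affine curve the principal fractional ideal of `g` is the product of the powers
`P ^ D(P)`, and the order of `g` at infinity is `D(∞)`. -/
def HasDivisor (g : E.FunctionField) (D : E.Point →₀ ℤ) : Prop :=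
  FractionalIdeal.spanSingleton E.CoordinateRing⁰ g
      = ((D.prod fun P k => pointIdeal P ^ k :
          (FractionalIdeal E.CoordinateRing⁰ E.FunctionField)ˣ) :
          FractionalIdeal E.CoordinateRing⁰ E.FunctionField) ∧
    ∃ c : H, HasLeadingTerm g (-(D 0)) c

end Functions

/-! ### Frobenius twists -/

section Twist

variable {F : Type*} [Field F] [Fintype F] (W : WeierstrassCurve.Affine F)
  (H : Type*) [Field H] [Algebra F H]

/-- The `q`-power map on `H`, where `q` is the number of elements of `F`. -/
abbrev frob (F : Type*) [Field F] [Fintype F] (H : Type*) [Field H] [Algebra F H] : H →+* H :=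
  (FiniteField.frobeniusAlgHom F H).toRingHom

theorem polynomial_map_frob :
    (W⁄H).toAffine.polynomial.map (mapRingHom (frob F H)) = (W⁄H).toAffine.polynomial :=
  (WeierstrassCurve.Affine.baseChange_polynomial W (FiniteField.frobeniusAlgHom F H)).symm

/-- The twist `∑ c_{jk} t ^ j y ^ k ↦ ∑ c_{jk} ^ q t ^ j y ^ k` on the coordinate ring over `H`. -/
def twistRing : (W⁄H).toAffine.CoordinateRing →+* (W⁄H).toAffine.CoordinateRing :=
  AdjoinRoot.lift ((AdjoinRoot.of (W⁄H).toAffine.polynomial).comp (mapRingHom (frob F H)))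
    (AdjoinRoot.root (W⁄H).toAffine.polynomial)
    (by rw [← eval₂_map, polynomial_map_frob, AdjoinRoot.eval₂_root])

theorem twistRing_mk (x : H[X][Y]) :
    twistRing W H (WeierstrassCurve.Affine.CoordinateRing.mk (W⁄H).toAffine x)
      = WeierstrassCurve.Affine.CoordinateRing.mk (W⁄H).toAffine
          (x.map (mapRingHom (frob F H))) := by
  rw [twistRing, AdjoinRoot.lift_mk, ← eval₂_map]
  exact AdjoinRoot.aeval_eq (x.map (mapRingHom (frob F H)))

theorem twistRing_injective : Function.Injective (twistRing W H) := by
  refine (injective_iff_map_eq_zero _).mpr fun z hz => ?_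
  obtain ⟨p, q, rfl⟩ := WeierstrassCurve.Affine.CoordinateRing.exists_smul_basis_eq z
  rw [WeierstrassCurve.Affine.CoordinateRing.smul, WeierstrassCurve.Affine.CoordinateRing.smul,
    mul_one, map_add, map_mul, twistRing_mk, twistRing_mk, twistRing_mk, map_C, map_C, map_X] at hz
  have h := WeierstrassCurve.Affine.CoordinateRing.smul_basis_eq_zero
    (W' := (W⁄H).toAffine) (p := p.map (frob F H)) (q := q.map (frob F H)) (by
      rw [WeierstrassCurve.Affine.CoordinateRing.smul,
        WeierstrassCurve.Affine.CoordinateRing.smul, mul_one]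
      exact hz)
  have hp := (Polynomial.map_eq_zero_iff (frob F H).injective).mp h.1
  have hq := (Polynomial.map_eq_zero_iff (frob F H).injective).mp h.2
  simp [hp, hq]

/-- The twist `g ↦ g⁽¹⁾` on the function field over `H`. -/
def twist : (W⁄H).toAffine.FunctionField →+* (W⁄H).toAffine.FunctionField :=
  IsFractionRing.map (twistRing_injective W H)

variable {W H}

/-- The Frobenius map `X ↦ X⁽¹⁾` on `H`-rational points: raise both coordinates to the power `q`. -/
def frobPoint [DecidableEq H] :
    WeierstrassCurve.Affine.Point (W⁄H) →+ WeierstrassCurve.Affine.Point (W⁄H) :=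
  WeierstrassCurve.Affine.Point.map (W' := W) (FiniteField.frobeniusAlgHom F H)

end Twist

/-! ### The generic point -/

section Generic

variable {F : Type*} [Field F] (W : WeierstrassCurve.Affine F)
  (H : Type*) [Field H] [Algebra F H] [Algebra W.FunctionField H]

/-- The embedding `ι : 𝐀 → K ⊆ H`, with `ι t = θ` and `ι y = η`. -/
def iota : W.CoordinateRing →+* H :=
  (algebraMap W.FunctionField H).comp (algebraMap W.CoordinateRing W.FunctionField)

/-- The elements `θ = ι t` and `η = ι y` of `H`. -/
def thetaElt : H := iota W H (tCoord W)

/-- See `thetaElt`. -/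
def etaElt : H := iota W H (yCoord W)

variable [IsScalarTower F W.FunctionField H]

theorem iota_algebraMap (c : F) :
    iota W H (algebraMap F W.CoordinateRing c) = algebraMap F H c := by
  rw [iota, RingHom.comp_apply, ← IsScalarTower.algebraMap_apply F W.CoordinateRing,
    ← IsScalarTower.algebraMap_apply F W.FunctionField]

theorem equation_generic : (W⁄H).toAffine.Equation (thetaElt W H) (etaElt W H) := by
  have h : iota W H (WeierstrassCurve.Affine.CoordinateRing.mk W W.polynomial) = 0 := by
    rw [AdjoinRoot.mk_self, map_zero]
  have hc (c : F) : iota W H (WeierstrassCurve.Affine.CoordinateRing.mk W (C (C c)))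
      = algebraMap F H c := iota_algebraMap W H c
  simp only [WeierstrassCurve.Affine.polynomial, map_add, map_sub, map_mul, map_pow, hc] at h
  rw [WeierstrassCurve.Affine.equation_iff']
  rw [add_mul] at h
  simpa only [add_assoc] using! h

instance [W.IsElliptic] : (W⁄H).toAffine.IsElliptic :=
  inferInstanceAs (W.map (algebraMap F H)).IsElliptic

/-- The point `Ξ = (θ, η)`. -/
def Xi [W.IsElliptic] : WeierstrassCurve.Affine.Point (W⁄H) :=
  WeierstrassCurve.Affine.Point.mk (equation_generic W H)

end Generic

/-! ### The shtuka function, the functions `g_j`, and the constants -/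

section Motive

variable {F : Type*} [Field F] [Fintype F] {W : WeierstrassCurve.Affine F}
  {H : Type*} [Field H] [DecidableEq H] [Algebra F H] [Algebra W.FunctionField H]
  [IsScalarTower F W.FunctionField H] [W.IsElliptic]

/-- `f` is a shtuka function for `V`: its sign is `1` and its divisor is
`(V⁽¹⁾) - (V) + (Ξ) - (∞)`. -/
def IsShtukaFunction (V : WeierstrassCurve.Affine.Point (W⁄H))
    (f : (W⁄H).toAffine.FunctionField) : Prop :=
  HasDivisor f (Finsupp.single (frobPoint V) 1 - Finsupp.single V 1
      + Finsupp.single (Xi W H) 1 - Finsupp.single 0 1) ∧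
    HasSignOne f

/-- `g 0, …, g (n - 1)` are the functions `g_1, …, g_n`: the sign of `g_j` is `1` and its divisor is
`-n (V) + (n - j) (∞) + (j - 1) (Ξ) + ([j - 1] V⁽¹⁾ + [n - (j - 1)] V)`. Here `j` is `i + 1`. -/
def IsTauBasis (V : WeierstrassCurve.Affine.Point (W⁄H)) (n : ℕ)
    (g : Fin n → (W⁄H).toAffine.FunctionField) : Prop :=
  ∀ i : Fin n,
    HasDivisor (g i) (Finsupp.single V (-(n : ℤ)) + Finsupp.single 0 ((n : ℤ) - ((i : ℕ) + 1))
        + Finsupp.single (Xi W H) ((i : ℕ) : ℤ)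
        + Finsupp.single ((i : ℕ) • frobPoint V + (n - (i : ℕ)) • V) 1) ∧
      HasSignOne (g i)

/-- The operator `τ h = f ^ n h⁽¹⁾`. -/
def tauOp (f : (W⁄H).toAffine.FunctionField) (n : ℕ) (h : (W⁄H).toAffine.FunctionField) :
    (W⁄H).toAffine.FunctionField :=
  f ^ n * twist W H h

/-- The extension of `g_1, …, g_n` to all positive indices by `g_{kn+j} = τ ^ k g_j`. Indices are
shifted by one: `gExt f g m` is `g_{m+1}`. -/
def gExt (f : (W⁄H).toAffine.FunctionField) {n : ℕ} (g : Fin n → (W⁄H).toAffine.FunctionField)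
    (m : ℕ) : (W⁄H).toAffine.FunctionField :=
  if h : 0 < n then (tauOp f n)^[m / n] (g ⟨m % n, Nat.mod_lt m h⟩) else 0

/-- A constant of `H`, or a regular function over `H`, as an element of the function field. -/
abbrev const (c : H) : (W⁄H).toAffine.FunctionField :=
  algebraMap (W⁄H).toAffine.CoordinateRing _ (algebraMap H _ c)

/-- See `const`. -/
abbrev regular (a : (W⁄H).toAffine.CoordinateRing) : (W⁄H).toAffine.FunctionField :=
  algebraMap (W⁄H).toAffine.CoordinateRing _ a

/-- The constants `a_i, y_i, z_i` (`1 ≤ i ≤ n`) are those for which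
`t g_i = θ g_i + a_i g_{i+1} + g_{i+2}` and
`y g_i = η g_i + y_i g_{i+1} + z_i g_{i+2} + g_{i+3}`. -/
def AreStructureConstants (f : (W⁄H).toAffine.FunctionField) {n : ℕ}
    (g : Fin n → (W⁄H).toAffine.FunctionField) (a y z : Fin n → H) : Prop :=
  ∀ i : Fin n,
    regular (tCoord _) * gExt f g (i : ℕ)
        = const (thetaElt W H) * gExt f g (i : ℕ) + const (a i) * gExt f g ((i : ℕ) + 1)
          + gExt f g ((i : ℕ) + 2) ∧
      regular (yCoord _) * gExt f g (i : ℕ)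
        = const (etaElt W H) * gExt f g (i : ℕ) + const (y i) * gExt f g ((i : ℕ) + 1)
          + const (z i) * gExt f g ((i : ℕ) + 2) + gExt f g ((i : ℕ) + 3)

end Motive

/-! ### The ring `Mat_n(H)[τ]` and Anderson modules -/

section Twisted

variable (F : Type*) [Field F] [Fintype F] (H : Type*) [Field H] [Algebra F H] (n : ℕ)

/-- The ring `Mat_n(H)`, on which `τ` acts by raising all entries to the power `q = #F`. -/
def TwMatrix (_F : Type*) (H : Type*) (n : ℕ) : Type _ := Matrix (Fin n) (Fin n) H

instance : Ring (TwMatrix F H n) := inferInstanceAs (Ring (Matrix (Fin n) (Fin n) H))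

instance : Algebra H (TwMatrix F H n) :=
  inferInstanceAs (Algebra H (Matrix (Fin n) (Fin n) H))

instance : Algebra F (TwMatrix F H n) :=
  inferInstanceAs (Algebra F (Matrix (Fin n) (Fin n) H))

/-- The ring endomorphism `M ↦ M⁽¹⁾` of `Mat_n(H)`. -/
def twistMatrix : TwMatrix F H n →+* TwMatrix F H n :=
  (frob F H).mapMatrix (m := Fin n)

/-- `Multiplicative ℕ` acts on `Mat_n(H)` through the powers of the twist, so that in the skew
polynomial ring the variable `τ = SkewPolynomial.X` satisfies `τ M = M⁽¹⁾ τ`. -/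
instance : MulSemiringAction (Multiplicative ℕ) (TwMatrix F H n) where
  smul k M := (twistMatrix F H n)^[k.toAdd] M
  one_smul _ := rfl
  mul_smul k l M := Function.iterate_add_apply (twistMatrix F H n) k.toAdd l.toAdd M
  smul_zero k := iterate_map_zero (twistMatrix F H n) k.toAdd
  smul_add k M N := iterate_map_add (twistMatrix F H n) k.toAdd M N
  smul_one k := iterate_map_one (twistMatrix F H n) k.toAdd
  smul_mul k M N := iterate_map_mul (twistMatrix F H n) k.toAdd M N

/-- The ring `Mat_n(H)[τ]` of twisted polynomials, with `τ M = M⁽¹⁾ τ`. -/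
abbrev TwPoly : Type _ := SkewPolynomial (TwMatrix F H n)

theorem twistMatrix_algebraMap (c : F) :
    twistMatrix F H n (algebraMap F (TwMatrix F H n) c) = algebraMap F (TwMatrix F H n) c := by
  change (frob F H).mapMatrix (algebraMap F (Matrix (Fin n) (Fin n) H) c)
    = algebraMap F (Matrix (Fin n) (Fin n) H) c
  exact ((FiniteField.frobeniusAlgHom F H).mapMatrix (m := Fin n)).commutes c

theorem phi_iterate_algebraMap (k : ℕ) (c : F) :
    (SkewPolynomial.φ (R := TwMatrix F H n))^[k] (algebraMap F (TwMatrix F H n) c)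
      = algebraMap F (TwMatrix F H n) c :=
  Function.iterate_fixed (f := SkewPolynomial.φ (R := TwMatrix F H n))
    (twistMatrix_algebraMap F H n c) k

/-- Elements of `F` are central in `Mat_n(H)[τ]`. -/
instance : Algebra F (TwPoly F H n) :=
  RingHom.toAlgebra' (SkewPolynomial.CRingHom.comp (algebraMap F (TwMatrix F H n))) fun c p => by
    rw [RingHom.comp_apply, SkewPolynomial.CRingHom_eq_C]
    induction p using SkewPolynomial.induction with
    | h0 => simp
    | ha k r p _ _ ih =>
      rw [mul_add, add_mul, ih, SkewPolynomial.C_mul_monomial, SkewPolynomial.monomial_mul_C,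
        phi_iterate_algebraMap, Algebra.commutes]

variable {F H n}

/-- A homomorphism `ρ : 𝐀 → Mat_n(H)[τ]` of `F`-algebras is an `n`-dimensional Anderson
`𝐀`-module if `d[a] - ι(a) I` is nilpotent for every `a`, where `d[a]` is the coefficient
of `τ ^ 0` in `ρ_a`. -/
def IsAndersonModule {W : WeierstrassCurve.Affine F} [Algebra W.FunctionField H]
    (ρ : W.CoordinateRing →ₐ[F] TwPoly F H n) : Prop :=
  ∀ a : W.CoordinateRing,
    IsNilpotent (SkewPolynomial.coeff (ρ a) 0 - algebraMap H (TwMatrix F H n) (iota W H a))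

end Twisted

/-! ### The matrices defining the tensor power -/

section Matrices

variable (F : Type*) {H : Type*} [Field H] {n : ℕ}

/-- The matrix `d[θ]`: diagonal entries `θ`, then `a_1, …, a_{n-1}` and `1, …, 1` on the first two
superdiagonals. -/
def dTheta (θ : H) (a : Fin n → H) : TwMatrix F H n :=
  Matrix.of fun i j : Fin n =>
    if (j : ℕ) = (i : ℕ) then θ else if (j : ℕ) = (i : ℕ) + 1 then a i
    else if (j : ℕ) = (i : ℕ) + 2 then 1 else 0

/-- The matrix `E_θ`: in the lower left corner, the last row begins with `a_n, 1` and the last but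
one row with `1`; all other entries are `0`. -/
def eTheta (a : Fin n → H) : TwMatrix F H n :=
  Matrix.of fun i j : Fin n =>
    if (j : ℕ) + n = (i : ℕ) + 1 then a i else if (j : ℕ) + n = (i : ℕ) + 2 then 1 else 0

/-- The matrix `d[η]`: diagonal entries `η`, then `y_1, …, y_{n-1}`, `z_1, …, z_{n-2}` and
`1, …, 1` on the first three superdiagonals. -/
def dEta (η : H) (y z : Fin n → H) : TwMatrix F H n :=
  Matrix.of fun i j : Fin n =>
    if (j : ℕ) = (i : ℕ) then η else if (j : ℕ) = (i : ℕ) + 1 then y i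
    else if (j : ℕ) = (i : ℕ) + 2 then z i else if (j : ℕ) = (i : ℕ) + 3 then 1 else 0

/-- The matrix `E_η`: in the lower left corner, the last three rows begin with `1`, with
`z_{n-1}, 1` and with `y_n, z_n, 1`; all other entries are `0`. For `n = 2` this is the part
`(z_1, 1; y_2, z_2)` that lies inside a `2 × 2` matrix. -/
def eEta (y z : Fin n → H) : TwMatrix F H n :=
  Matrix.of fun i j : Fin n =>
    if (j : ℕ) + n = (i : ℕ) + 1 then y i else if (j : ℕ) + n = (i : ℕ) + 2 then z i
    else if (j : ℕ) + n = (i : ℕ) + 3 then 1 else 0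

/-- The coefficient of `τ ^ 2` in `ρ_y`. It vanishes for `n ≥ 3`. For `n = 2` its only nonzero entry
is the `1` in the lower left corner, since then `g_{n+3} = g_5 = τ ^ 2 g_1`. -/
def eEtaTwo : TwMatrix F H n :=
  Matrix.of fun i j : Fin n => if n = 2 ∧ (i : ℕ) = 1 ∧ (j : ℕ) = 0 then 1 else 0

variable [Field F] [Fintype F] [Algebra F H]

/-- `ρ_t = d[θ] + E_θ τ`. -/
def rhoT (θ : H) (a : Fin n → H) : TwPoly F H n :=
  SkewPolynomial.C (dTheta F θ a) + SkewPolynomial.C (eTheta F a) * SkewPolynomial.X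

/-- `ρ_y = d[η] + E_η τ`, with an additional term in `τ ^ 2` if `n = 2`. -/
def rhoY (η : H) (y z : Fin n → H) : TwPoly F H n :=
  SkewPolynomial.C (dEta F η y z) + SkewPolynomial.C (eEta F y z) * SkewPolynomial.X
    + SkewPolynomial.C (eEtaTwo F) * SkewPolynomial.X ^ 2

end Matrices

end

end AndersonTensor

open AndersonTensor

/-! On an elliptic curve a divisor of degree 0 is principal exactly when its points sum to zero. The
divisors prescribed for `f` and the `g_j` satisfy both conditions because `Ξ = V - V⁽¹⁾`. A function
is determined by its divisor up to a constant, and the sign fixes that constant.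

Riemann-Roch is replaced by an elementary degree count. An ideal built from rational points has a
norm in `H[t]`, namely its product with its conjugate under the elliptic involution. A nonzero
function in a fractional ideal of degree `d` therefore has pole order at least `d` at infinity, and
if equality holds it generates the ideal (`HasDegree.le`). In that case injectivity of
`Point.toClass` forces the points of the divisor to sum to zero (`sum_eq_zero_of_poleLE`).

The points `[j]V⁽¹⁾ + [n-j]V` must be finite also for `j = 0` and `j = n`, that is, `V` must not be
`n`-torsion. Otherwise `Ξ` would be torsion too. But `θ` is transcendental over the finite field,
and the duplication formula has degree 4 in the abscissa, so the points `[2^k]Ξ` never repeat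
(`nsmul_ne_zero_of_transcendental`).

With indices starting at 0, `gExt f g m` has sign 1 and pole order `m + 1 - n`
(`hasLeadingTerm_gExt`). On the affine curve its divisor is at least `-n(V) + min(m,n)(Ξ)`
(`gExt_mem_motiveIdeal`). Multiplying the function of index `i < n` by `t - θ` or `y - η` gains one
more zero at `Ξ`. Subtracting suitable multiples of the next functions lowers the pole order to at
most `i + 1 - n`, the degree of `-n(V) + (i+1)(Ξ)`. A nonzero remainder would make `[i+1]V⁽¹⁾ +
[n-i-1]V` vanish, so the remainder is 0 (`eq_zero_of_mem_motiveIdeal`). Distinct pole orders make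
all these functions linearly independent over `H`, so the constants are unique.

Finally `Mat_n(H)[τ]` acts on column vectors of functions. By linear independence a twisted
polynomial is determined by its value on the vector `g` (`twEval_injective`), and the relations say
that `ρ_t` and `ρ_y` act on `g` as multiplication by `t` and `y`. As functions defined over the
finite field are fixed by the twist, every `a` in the coordinate ring has a unique `ρ_a` with `ρ_a g
= a g`, and uniqueness makes `a ↦ ρ_a` a homomorphism (`exists_algHom_of_twEval`). Its constant
coefficients are upper triangular with diagonal `ι(a)`, which gives nilpotence. -/

namespace AndersonTensor

noncomputable section

open WeierstrassCurve.Affine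

/-! ### Pole order and sign at infinity as a valuation with leading coefficients -/

section LeadingTerm

variable {H : Type*} [Field H] {E : WeierstrassCurve.Affine H}

/-- The polynomial `p(s²) + q(s²) s³` attached to the regular function `p(t) + q(t) y`. Its degree
is the pole order and its leading coefficient is the sign. -/
def weightPoly : E.CoordinateRing →ₗ[H] H[X] where
  toFun a := expand H 2 ((CoordinateRing.basis E).repr a 0)
    + expand H 2 ((CoordinateRing.basis E).repr a 1) * X ^ 3
  map_add' a b := by simp; ring
  map_smul' c a := by
    rw [← IsScalarTower.algebraMap_smul H[X] c a]
    simp only [map_smul, Finsupp.smul_apply, Polynomial.algebraMap_eq, smul_eq_mul, map_mul,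
      expand_C, RingHom.id_apply, smul_eq_C_mul]
    ring

theorem weightPoly_apply (p q : H[X]) :
    weightPoly (p • (1 : E.CoordinateRing) + q • CoordinateRing.mk E Y)
      = expand H 2 p + expand H 2 q * X ^ 3 := by
  simp only [weightPoly, LinearMap.coe_mk, AddHom.coe_mk, ← CoordinateRing.basis_zero,
    ← CoordinateRing.basis_one, map_add, map_smul, Finsupp.smul_apply, Module.Basis.repr_self,
    smul_eq_mul]
  simp

theorem repr_smul_basis (p q : H[X]) :
    (CoordinateRing.basis E).repr (p • (1 : E.CoordinateRing) + q • CoordinateRing.mk E Y) 0 = p ∧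
    (CoordinateRing.basis E).repr (p • (1 : E.CoordinateRing) + q • CoordinateRing.mk E Y) 1
      = q := by
  simp only [← CoordinateRing.basis_zero,
    ← CoordinateRing.basis_one, map_add, map_smul, Finsupp.add_apply, Finsupp.smul_apply,
    Module.Basis.repr_self, smul_eq_mul]
  simp

theorem degree_expand_two (p : H[X]) : (expand H 2 p).degree = 2 • p.degree := by
  by_cases hp : p = 0
  · simp [hp]
  · rw [degree_eq_natDegree hp, degree_eq_natDegree ((expand_ne_zero two_pos).mpr hp),
      natDegree_expand]
    simp [mul_comm]

/-- Parity: pole orders from the `t`-part are even and those from the `y`-part odd, so leading terms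
never cancel. -/
theorem two_nsmul_degree_ne (p q : H[X]) (hp : p ≠ 0) :
    2 • p.degree ≠ 2 • q.degree + 3 := by
  intro h
  by_cases hq : q = 0
  · rw [hq, degree_eq_natDegree hp, degree_zero] at h
    simp [nsmul_eq_mul] at h
    exact absurd h (by exact_mod_cast WithBot.coe_ne_bot)
  · rw [degree_eq_natDegree hp, degree_eq_natDegree hq] at h
    have h' : 2 * p.natDegree = 2 * q.natDegree + 3 := by
      simp only [nsmul_eq_mul] at h
      exact_mod_cast h
    omega

theorem degree_leadingCoeff_weight (p q : H[X]) :
    (expand H 2 p + expand H 2 q * X ^ 3).degree = max (2 • p.degree) (2 • q.degree + 3) ∧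
    (expand H 2 p + expand H 2 q * X ^ 3).leadingCoeff
      = if 2 • q.degree + 3 < 2 • p.degree then p.leadingCoeff else q.leadingCoeff := by
  have hp := degree_expand_two p
  have hq : (expand H 2 q * X ^ 3).degree = 2 • q.degree + 3 := by
    rw [degree_mul, degree_expand_two, degree_X_pow]; rfl
  split_ifs with h
  · constructor
    · rw [degree_add_eq_left_of_degree_lt (by rw [hp, hq]; exact h), max_eq_left h.le, hp]
    · rw [leadingCoeff_add_of_degree_lt' (by rw [hp, hq]; exact h), leadingCoeff_expand two_pos]
  · by_cases hp0 : p = 0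
    · subst hp0
      simp only [map_zero, zero_add, hq, leadingCoeff_mul, leadingCoeff_X_pow, mul_one,
        leadingCoeff_expand two_pos, and_true, degree_zero]
      exact (max_eq_right (by simp [nsmul_eq_mul])).symm
    · have h' := lt_of_le_of_ne (not_lt.mp h) (two_nsmul_degree_ne p q hp0)
      constructor
      · rw [degree_add_eq_right_of_degree_lt (by rw [hp, hq]; exact h'), max_eq_right h'.le, hq]
      · rw [leadingCoeff_add_of_degree_lt (by rw [hp, hq]; exact h'), leadingCoeff_mul,
          leadingCoeff_X_pow, mul_one, leadingCoeff_expand two_pos]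

theorem degree_weightPoly (a : E.CoordinateRing) :
    (weightPoly a).degree = (Algebra.norm H[X] a).degree := by
  obtain ⟨p, q, rfl⟩ := CoordinateRing.exists_smul_basis_eq a
  rw [weightPoly_apply, CoordinateRing.degree_norm_smul_basis,
    (degree_leadingCoeff_weight p q).1]

theorem natDegree_weightPoly (a : E.CoordinateRing) : (weightPoly a).natDegree = poleOrder a :=
  natDegree_eq_of_degree_eq (degree_weightPoly a)

theorem leadingCoeff_weightPoly (a : E.CoordinateRing) :
    (weightPoly a).leadingCoeff = leadCoeff a := by
  obtain ⟨p, q, rfl⟩ := CoordinateRing.exists_smul_basis_eq a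
  rw [weightPoly_apply, (degree_leadingCoeff_weight p q).2, leadCoeff]
  simp only [repr_smul_basis]

theorem weightPoly_eq_zero {a : E.CoordinateRing} : weightPoly a = 0 ↔ a = 0 := by
  rw [← degree_eq_bot, degree_weightPoly, degree_eq_bot,
    Algebra.norm_eq_zero_iff_of_basis (CoordinateRing.basis E)]

theorem norm_ne_zero {a : E.CoordinateRing} (ha : a ≠ 0) : Algebra.norm H[X] a ≠ 0 :=
  (Algebra.norm_eq_zero_iff_of_basis (CoordinateRing.basis E)).not.mpr ha

theorem leadCoeff_ne_zero {a : E.CoordinateRing} (ha : a ≠ 0) : leadCoeff a ≠ 0 := by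
  rw [← leadingCoeff_weightPoly]
  exact leadingCoeff_ne_zero.mpr (weightPoly_eq_zero.not.mpr ha)

theorem mk_Y_sq : CoordinateRing.mk E Y * CoordinateRing.mk E Y
    = (X ^ 3 + C E.a₂ * X ^ 2 + C E.a₄ * X + C E.a₆) • (1 : E.CoordinateRing)
      + (-(C E.a₁ * X + C E.a₃)) • CoordinateRing.mk E Y := by
  have := CoordinateRing.smul_basis_mul_Y (W' := E) 0 1
  simp only [zero_smul, zero_add, one_smul, one_mul, zero_sub] at this
  rw [this]

/-- Giving `t` and `y` the weights 2 and 3 turns the curve into `y² = t³`, on which `s ↦ (s², s³)`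
is multiplicative. The error `r` comes from the remaining terms of the Weierstrass equation, and
these have weight below 6. Hence signs multiply. -/
theorem weightPoly_mul (a b : E.CoordinateRing) : ∃ r : H[X],
    weightPoly (a * b) = weightPoly a * weightPoly b + r ∧
      (a ≠ 0 → b ≠ 0 → r.degree < (weightPoly a * weightPoly b).degree) := by
  obtain ⟨p, q, rfl⟩ := CoordinateRing.exists_smul_basis_eq a
  obtain ⟨p', q', rfl⟩ := CoordinateRing.exists_smul_basis_eq b
  have hmul : (p • (1 : E.CoordinateRing) + q • CoordinateRing.mk E Y)
        * (p' • (1 : E.CoordinateRing) + q' • CoordinateRing.mk E Y)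
      = (p * p' + q * q' * (X ^ 3 + C E.a₂ * X ^ 2 + C E.a₄ * X + C E.a₆))
          • (1 : E.CoordinateRing)
        + (p * q' + p' * q - q * q' * (C E.a₁ * X + C E.a₃)) • CoordinateRing.mk E Y := by
    have h := mk_Y_sq (E := E)
    simp only [Algebra.smul_def, mul_one] at h ⊢
    simp only [map_add, map_mul, map_sub, map_neg] at h ⊢
    linear_combination (algebraMap H[X] E.CoordinateRing q * algebraMap H[X] E.CoordinateRing q') * h
  refine ⟨expand H 2 (q * q') * (C E.a₂ * X ^ 4 + C E.a₄ * X ^ 2 + C E.a₆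
    - (C E.a₁ * X ^ 2 + C E.a₃) * X ^ 3), ?_, fun ha hb => ?_⟩
  · rw [hmul, weightPoly_apply, weightPoly_apply, weightPoly_apply]
    simp only [map_add, map_sub, map_mul, map_pow, expand_X, expand_C]
    ring
  · have h0 : weightPoly (p • (1 : E.CoordinateRing) + q • CoordinateRing.mk E Y)
        * weightPoly (p' • (1 : E.CoordinateRing) + q' • CoordinateRing.mk E Y) ≠ 0 :=
      mul_ne_zero (weightPoly_eq_zero.not.mpr ha) (weightPoly_eq_zero.not.mpr hb)
    by_cases hqq : q * q' = 0
    · simp only [hqq, map_zero, zero_mul, degree_zero]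
      exact bot_lt_iff_ne_bot.mpr (degree_ne_bot.mpr h0)
    -- Each factor containing `y` contributes an extra weight 3 to the product, 6 in total, while
    -- the correction contributes at most 5.
    · have h5 : (C E.a₂ * X ^ 4 + C E.a₄ * X ^ 2 + C E.a₆
          - (C E.a₁ * X ^ 2 + C E.a₃) * X ^ 3 : H[X]).degree ≤ 5 := by
        compute_degree
      have hq : 2 • q.degree + 3 ≤
          (weightPoly (p • (1 : E.CoordinateRing) + q • CoordinateRing.mk E Y)).degree := by
        rw [weightPoly_apply, (degree_leadingCoeff_weight p q).1]; exact le_max_right _ _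
      have hq' : 2 • q'.degree + 3 ≤
          (weightPoly (p' • (1 : E.CoordinateRing) + q' • CoordinateRing.mk E Y)).degree := by
        rw [weightPoly_apply, (degree_leadingCoeff_weight p' q').1]; exact le_max_right _ _
      rw [degree_mul, degree_mul, degree_expand_two, degree_mul]
      refine lt_of_lt_of_le ?_ (add_le_add hq hq')
      refine lt_of_le_of_lt (add_le_add_right h5 _) ?_
      obtain ⟨h1, h2⟩ := mul_ne_zero_iff.mp hqq
      rw [degree_eq_natDegree h1, degree_eq_natDegree h2]
      simp only [nsmul_eq_mul]
      norm_cast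
      omega

theorem poleOrder_mul {a b : E.CoordinateRing} (ha : a ≠ 0) (hb : b ≠ 0) :
    poleOrder (a * b) = poleOrder a + poleOrder b := by
  rw [poleOrder, map_mul, natDegree_mul (norm_ne_zero ha) (norm_ne_zero hb), poleOrder, poleOrder]

theorem leadCoeff_mul (a b : E.CoordinateRing) :
    leadCoeff (a * b) = leadCoeff a * leadCoeff b := by
  by_cases ha : a = 0
  · simp [ha, leadCoeff]
  by_cases hb : b = 0
  · simp [hb, leadCoeff]
  obtain ⟨r, h, hr⟩ := weightPoly_mul a b
  rw [← leadingCoeff_weightPoly, h, leadingCoeff_add_of_degree_lt' (hr ha hb), leadingCoeff_mul,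
    leadingCoeff_weightPoly, leadingCoeff_weightPoly]

theorem hasLeadingTerm_algebraMap {a : E.CoordinateRing} (ha : a ≠ 0) :
    HasLeadingTerm (algebraMap E.CoordinateRing E.FunctionField a) (poleOrder a) (leadCoeff a) :=
  ⟨a, 1, ha, one_ne_zero, by simp, by simp [poleOrder], by
    rw [← leadingCoeff_weightPoly (1 : E.CoordinateRing)]
    have := weightPoly_apply (E := E) 1 0
    simp only [one_smul, zero_smul, add_zero, map_one, map_zero, zero_mul] at this
    rw [this, leadingCoeff_one, mul_one]⟩

theorem HasLeadingTerm.ne_zero {g : E.FunctionField} {d : ℤ} {c : H}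
    (h : HasLeadingTerm g d c) : g ≠ 0 := by
  obtain ⟨a, b, ha, hb, hg, -, -⟩ := h
  rintro rfl
  rw [zero_mul, eq_comm, FaithfulSMul.algebraMap_eq_zero_iff] at hg
  exact ha hg

theorem HasLeadingTerm.coeff_ne_zero {g : E.FunctionField} {d : ℤ} {c : H}
    (h : HasLeadingTerm g d c) : c ≠ 0 := by
  obtain ⟨a, b, ha, hb, hg, -, hc⟩ := h
  rintro rfl
  exact leadCoeff_ne_zero ha (by rw [hc, zero_mul])

theorem HasLeadingTerm.unique {g : E.FunctionField} {d d' : ℤ} {c c' : H}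
    (h : HasLeadingTerm g d c) (h' : HasLeadingTerm g d' c') : d = d' ∧ c = c' := by
  obtain ⟨a, b, ha, hb, hg, hd, hc⟩ := h
  obtain ⟨a', b', ha', hb', hg', hd', hc'⟩ := h'
  have key : a * b' = a' * b := by
    apply FaithfulSMul.algebraMap_injective E.CoordinateRing E.FunctionField
    rw [map_mul, map_mul, ← hg, ← hg']
    ring
  constructor
  · have := congrArg poleOrder key
    rw [poleOrder_mul ha hb', poleOrder_mul ha' hb] at this
    omega
  · have := congrArg leadCoeff key
    rw [leadCoeff_mul, leadCoeff_mul, hc, hc'] at this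
    have h0 := mul_ne_zero (leadCoeff_ne_zero hb) (leadCoeff_ne_zero hb')
    apply mul_right_cancel₀ h0
    linear_combination this

theorem HasLeadingTerm.mul {g g' : E.FunctionField} {d d' : ℤ} {c c' : H}
    (h : HasLeadingTerm g d c) (h' : HasLeadingTerm g' d' c') :
    HasLeadingTerm (g * g') (d + d') (c * c') := by
  obtain ⟨a, b, ha, hb, hg, hd, hc⟩ := h
  obtain ⟨a', b', ha', hb', hg', hd', hc'⟩ := h'
  refine ⟨a * a', b * b', mul_ne_zero ha ha', mul_ne_zero hb hb', ?_, ?_, ?_⟩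
  · rw [map_mul, map_mul, ← hg, ← hg']; ring
  · rw [poleOrder_mul ha ha', poleOrder_mul hb hb']; push_cast; omega
  · rw [leadCoeff_mul, leadCoeff_mul, hc, hc']; ring

theorem exists_hasLeadingTerm {g : E.FunctionField} (hg : g ≠ 0) :
    ∃ d c, HasLeadingTerm g d c := by
  obtain ⟨a, b, hb, rfl⟩ := IsFractionRing.div_surjective (A := E.CoordinateRing) g
  have hb0 : b ≠ 0 := nonZeroDivisors.ne_zero hb
  have hb1 : algebraMap E.CoordinateRing E.FunctionField b ≠ 0 := by
    simpa [FaithfulSMul.algebraMap_eq_zero_iff] using hb0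
  have ha0 : a ≠ 0 := by rintro rfl; simp at hg
  exact ⟨_, leadCoeff a / leadCoeff b, a, b, ha0, hb0, div_mul_cancel₀ _ hb1, rfl,
    (div_mul_cancel₀ _ (leadCoeff_ne_zero hb0)).symm⟩

theorem hasLeadingTerm_one : HasLeadingTerm (1 : E.FunctionField) 0 1 :=
  ⟨1, 1, one_ne_zero, one_ne_zero, by simp, by simp, by simp⟩

theorem HasLeadingTerm.pow {g : E.FunctionField} {d : ℤ} {c : H} (h : HasLeadingTerm g d c)
    (n : ℕ) : HasLeadingTerm (g ^ n) (n * d) (c ^ n) := by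
  induction n with
  | zero => simpa using hasLeadingTerm_one
  | succ n ih =>
    rw [pow_succ, pow_succ]
    convert! ih.mul h using 1
    push_cast; ring

theorem HasLeadingTerm.smul {g : E.FunctionField} {d : ℤ} {c : H} (h : HasLeadingTerm g d c)
    {k : H} (hk : k ≠ 0) : HasLeadingTerm (k • g) d (k * c) := by
  obtain ⟨a, b, ha, hb, hg, hd, hc⟩ := h
  have hwt : weightPoly (k • a) = C k * weightPoly a := by rw [map_smul, smul_eq_C_mul]
  refine ⟨k • a, b, smul_ne_zero hk ha, hb, ?_, ?_, ?_⟩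
  · rw [smul_mul_assoc, hg]
    exact (map_smul (IsScalarTower.toAlgHom H E.CoordinateRing E.FunctionField) k a).symm
  · rw [← hd, ← natDegree_weightPoly, hwt, natDegree_C_mul hk, natDegree_weightPoly]
  · rw [← leadingCoeff_weightPoly, hwt, leadingCoeff_mul, leadingCoeff_C, leadingCoeff_weightPoly,
      hc, mul_assoc]

/-- The function `g` is zero or has pole order at most `d` at infinity. -/
def PoleLE (g : E.FunctionField) (d : ℤ) : Prop :=
  ∀ e c, HasLeadingTerm g e c → e ≤ d

theorem poleLE_zero (d : ℤ) : PoleLE (0 : E.FunctionField) d :=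
  fun _ _ h => absurd rfl h.ne_zero

theorem HasLeadingTerm.poleLE {g : E.FunctionField} {d : ℤ} {c : H} (h : HasLeadingTerm g d c) :
    PoleLE g d := fun _ _ h' => (h'.unique h).1.le

theorem PoleLE.mono {g : E.FunctionField} {d d' : ℤ} (h : PoleLE g d) (hd : d ≤ d') :
    PoleLE g d' := fun e c h' => (h e c h').trans hd

/-- Reduces bounds on pole orders to degrees of weight polynomials over a fixed denominator, where
sums are easy to handle. -/
theorem poleLE_iff {a b : E.CoordinateRing} (hb : b ≠ 0) {g : E.FunctionField}
    (hg : g * algebraMap E.CoordinateRing E.FunctionField b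
      = algebraMap E.CoordinateRing E.FunctionField a) (d : ℤ) :
    PoleLE g d ↔ (weightPoly a = 0 ∨ ((weightPoly a).natDegree : ℤ) - poleOrder b ≤ d) := by
  have hb1 : algebraMap E.CoordinateRing E.FunctionField b ≠ 0 := by
    simpa [FaithfulSMul.algebraMap_eq_zero_iff] using hb
  rw [weightPoly_eq_zero, natDegree_weightPoly]
  by_cases ha : a = 0
  · rw [ha, map_zero, mul_eq_zero, or_iff_left hb1] at hg
    simp [ha, hg, poleLE_zero]
  · have hlt : HasLeadingTerm g (poleOrder a - poleOrder b) (leadCoeff a / leadCoeff b) :=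
      ⟨a, b, ha, hb, hg, rfl, (div_mul_cancel₀ _ (leadCoeff_ne_zero hb)).symm⟩
    simp only [ha, false_or]
    exact ⟨fun h => h _ _ hlt, fun h => hlt.poleLE.mono h⟩

theorem exists_common_denominator (g g' : E.FunctionField) : ∃ a a' b : E.CoordinateRing, b ≠ 0 ∧
    g * algebraMap E.CoordinateRing E.FunctionField b
      = algebraMap E.CoordinateRing E.FunctionField a ∧
    g' * algebraMap E.CoordinateRing E.FunctionField b
      = algebraMap E.CoordinateRing E.FunctionField a' := by
  obtain ⟨b, h⟩ := IsLocalization.exist_integer_multiples_of_finset E.CoordinateRing⁰ {g, g'}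
  obtain ⟨a, ha⟩ := h g (by simp)
  obtain ⟨a', ha'⟩ := h g' (by simp)
  exact ⟨a, a', b, nonZeroDivisors.ne_zero b.2, by rw [ha, Algebra.smul_def, mul_comm],
    by rw [ha', Algebra.smul_def, mul_comm]⟩

theorem PoleLE.add {g g' : E.FunctionField} {d : ℤ} (h : PoleLE g d) (h' : PoleLE g' d) :
    PoleLE (g + g') d := by
  obtain ⟨a, a', b, hb, ha, ha'⟩ := exists_common_denominator g g'
  rw [poleLE_iff hb ha] at h
  rw [poleLE_iff hb ha'] at h'
  rw [poleLE_iff hb (a := a + a') (by rw [add_mul, ha, ha', map_add]), map_add]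
  rcases h with h | h
  · simpa [h] using h'
  rcases h' with h' | h'
  · simp [h', h]
  · right
    have := natDegree_add_le (weightPoly a) (weightPoly a')
    omega

theorem PoleLE.smul {g : E.FunctionField} {d : ℤ} (h : PoleLE g d) (k : H) : PoleLE (k • g) d := by
  by_cases hk : k = 0
  · simpa [hk] using poleLE_zero d
  · by_cases hg : g = 0
    · simpa [hg] using poleLE_zero d
    obtain ⟨e, c, he⟩ := exists_hasLeadingTerm hg
    exact (he.smul hk).poleLE.mono (h _ _ he)

theorem HasLeadingTerm.add_poleLE {g g' : E.FunctionField} {d : ℤ} {c : H}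
    (h : HasLeadingTerm g d c) (h' : PoleLE g' (d - 1)) : HasLeadingTerm (g + g') d c := by
  obtain ⟨a, a', b, hb, ha, ha'⟩ := exists_common_denominator g g'
  have ha0 : a ≠ 0 := by
    rintro rfl
    rw [map_zero, mul_eq_zero, FaithfulSMul.algebraMap_eq_zero_iff] at ha
    exact ha.elim h.ne_zero hb
  have hlt : HasLeadingTerm g (poleOrder a - poleOrder b) (leadCoeff a / leadCoeff b) :=
    ⟨a, b, ha0, hb, ha, rfl, (div_mul_cancel₀ _ (leadCoeff_ne_zero hb)).symm⟩
  obtain ⟨hd, hc⟩ := h.unique hlt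
  rw [poleLE_iff hb ha'] at h'
  have hdeg : (weightPoly a').degree < (weightPoly a).degree := by
    rcases h' with h' | h'
    · rw [h', degree_zero]
      exact bot_lt_iff_ne_bot.mpr (degree_ne_bot.mpr (weightPoly_eq_zero.not.mpr ha0))
    · apply degree_lt_degree
      rw [natDegree_weightPoly a]
      omega
  have h0 : a + a' ≠ 0 := by
    rw [Ne, ← weightPoly_eq_zero, map_add, ← Ne, ← degree_ne_bot,
      degree_add_eq_left_of_degree_lt hdeg, degree_ne_bot]
    exact weightPoly_eq_zero.not.mpr ha0
  refine ⟨a + a', b, h0, hb, by rw [add_mul, ha, ha', map_add], ?_, ?_⟩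
  · rw [hd, ← natDegree_weightPoly, map_add,
      natDegree_eq_of_degree_eq (degree_add_eq_left_of_degree_lt hdeg), natDegree_weightPoly]
  · rw [hc, ← leadingCoeff_weightPoly, map_add, leadingCoeff_add_of_degree_lt' hdeg,
      leadingCoeff_weightPoly, div_mul_cancel₀ _ (leadCoeff_ne_zero hb)]

/-- Equal leading terms cancel, so the pole order drops. This and `PoleLE.exists_sub_smul` are the
steps of the division algorithm that produces the structure constants. -/
theorem HasLeadingTerm.sub_poleLE {g g' : E.FunctionField} {d : ℤ} {c : H}
    (h : HasLeadingTerm g d c) (h' : HasLeadingTerm g' d c) : PoleLE (g - g') (d - 1) := by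
  intro e k he
  by_contra hlt
  rcases lt_or_eq_of_le (show d ≤ e by omega) with hde | rfl
  · have h1 : PoleLE (g - g') d := by
      rw [sub_eq_add_neg, ← neg_one_smul H g']
      exact h.poleLE.add (h'.poleLE.smul _)
    exact absurd (h1 e k he) (by omega)
  · obtain ⟨a, a', b, hb, ha, ha'⟩ := exists_common_denominator g g'
    have ne : ∀ {u : E.FunctionField} {v : E.CoordinateRing}, u ≠ 0 →
        u * algebraMap E.CoordinateRing E.FunctionField b
          = algebraMap E.CoordinateRing E.FunctionField v → v ≠ 0 := by
      rintro u v hu huv rfl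
      rw [map_zero, mul_eq_zero, FaithfulSMul.algebraMap_eq_zero_iff] at huv
      exact huv.elim hu hb
    have ha0 := ne h.ne_zero ha
    have ha0' := ne h'.ne_zero ha'
    have h1 := h.unique ⟨a, b, ha0, hb, ha, rfl, (div_mul_cancel₀ _ (leadCoeff_ne_zero hb)).symm⟩
    have h2 := h'.unique
      ⟨a', b, ha0', hb, ha', rfl, (div_mul_cancel₀ _ (leadCoeff_ne_zero hb)).symm⟩
    have hne := weightPoly_eq_zero.not.mpr ha0
    have hne' := weightPoly_eq_zero.not.mpr ha0'
    have hdeg : (weightPoly a - weightPoly a').degree < (weightPoly a).degree := by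
      refine degree_sub_lt_left ?_ hne ?_
      swap
      · rw [leadingCoeff_weightPoly, leadingCoeff_weightPoly]
        have := h1.2.symm.trans h2.2
        exact (div_left_inj' (leadCoeff_ne_zero hb)).mp this
      · rw [degree_eq_natDegree hne, degree_eq_natDegree hne', natDegree_weightPoly,
          natDegree_weightPoly]
        norm_cast
        omega
    have hs := (poleLE_iff hb (a := a - a') (g := g - g')
      (by rw [sub_mul, ha, ha', map_sub]) (d - 1)).mpr (by
        rw [map_sub]
        by_cases hz : weightPoly a - weightPoly a' = 0
        · exact Or.inl hz
        · have := natDegree_lt_natDegree hz hdeg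
          rw [natDegree_weightPoly a] at this
          right
          omega)
    exact absurd (hs _ _ he) (by omega)

theorem PoleLE.exists_sub_smul {g g' : E.FunctionField} {d : ℤ} (h : PoleLE g d)
    (h' : HasLeadingTerm g' d 1) : ∃ k : H, PoleLE (g - k • g') (d - 1) := by
  by_cases hg : g = 0
  · exact ⟨0, by simpa [hg] using poleLE_zero _⟩
  obtain ⟨e, c, he⟩ := exists_hasLeadingTerm hg
  rcases (h _ _ he).lt_or_eq with hlt | rfl
  · exact ⟨0, by simpa using he.poleLE.mono (by omega)⟩
  · refine ⟨c, he.sub_poleLE ?_⟩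
    simpa using h'.smul he.coeff_ne_zero

/-- In a linear combination the largest index with nonzero coefficient dominates at infinity and
cannot be cancelled. -/
theorem linearIndependent_of_strictMono_pole (g : ℕ → E.FunctionField) (d : ℕ → ℤ)
    (hd : StrictMono d) (h : ∀ i, ∃ c, HasLeadingTerm (g i) (d i) c) :
    LinearIndependent H g := by
  rw [linearIndependent_iff']
  intro s c hs
  by_contra! hne
  obtain ⟨i, hi, hci⟩ := hne
  classical
  let t := s.filter fun i => c i ≠ 0
  have ht : t.Nonempty := ⟨i, by simp [t, hi, hci]⟩
  obtain ⟨hm, hcm⟩ := Finset.mem_filter.mp (t.max'_mem ht)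
  set m := t.max' ht
  obtain ⟨k, hk⟩ := h m
  have hrest : PoleLE (∑ j ∈ s.erase m, c j • g j) (d m - 1) := by
    refine Finset.sum_induction _ (fun x => PoleLE x (d m - 1)) (fun _ _ => PoleLE.add)
      (poleLE_zero _) fun j hj => ?_
    by_cases hcj : c j = 0
    · simpa [hcj] using poleLE_zero _
    · have hjm : j < m := lt_of_le_of_ne
        (t.le_max' j (by simp [t, hcj, (Finset.mem_erase.mp hj).2])) (Finset.mem_erase.mp hj).1
      obtain ⟨l, hl⟩ := h j
      have := hd hjm
      exact (hl.poleLE.smul _).mono (by omega)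
  have := (hk.smul hcm).add_poleLE hrest
  rw [Finset.add_sum_erase s (fun j => c j • g j) hm, hs] at this
  exact this.ne_zero rfl

end LeadingTerm

end

end AndersonTensor

namespace AndersonTensor

noncomputable section

open WeierstrassCurve.Affine

/-! ### Norms and degrees of ideals; principal divisors -/

section Divisors

variable {H : Type*} [Field H] {E : WeierstrassCurve.Affine H}

variable (E) in
/-- The involution `y ↦ -y - a₁ t - a₃` of the coordinate ring. -/
def conj : E.CoordinateRing →+* E.CoordinateRing :=
  AdjoinRoot.lift (AdjoinRoot.of E.polynomial) (CoordinateRing.mk E E.negPolynomial) (by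
    have : E.polynomial.eval₂ (AdjoinRoot.of E.polynomial) (CoordinateRing.mk E E.negPolynomial)
        = CoordinateRing.mk E (E.polynomial.eval₂ C E.negPolynomial) := by
      rw [hom_eval₂]; rfl
    rw [this, AdjoinRoot.mk_eq_zero]
    -- Substituting `-Y - a₁X - a₃` for `Y` leaves the Weierstrass polynomial unchanged, so the
    -- quotient is 1.
    refine ⟨1, ?_⟩
    simp only [polynomial, negPolynomial, eval₂_sub, eval₂_add, eval₂_mul, eval₂_pow, eval₂_X,
      eval₂_C]
    ring)

theorem conj_algebraMap (p : H[X]) :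
    conj E (algebraMap H[X] E.CoordinateRing p) = algebraMap H[X] E.CoordinateRing p :=
  AdjoinRoot.lift_of _

theorem conj_Y : conj E (CoordinateRing.mk E Y) = CoordinateRing.mk E E.negPolynomial :=
  AdjoinRoot.lift_root _

theorem algebraMap_norm (a : E.CoordinateRing) :
    algebraMap H[X] E.CoordinateRing (Algebra.norm H[X] a) = a * conj E a := by
  obtain ⟨p, q, rfl⟩ := CoordinateRing.exists_smul_basis_eq a
  have h := CoordinateRing.coe_norm_smul_basis (W' := E) p q
  refine h.trans ?_
  rw [map_mul]
  congr 1
  · simp [Algebra.smul_def]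
  · simp only [map_add, Algebra.smul_def, map_mul, conj_algebraMap, conj_Y, mul_one,
      negPolynomial]
    rfl

theorem conj_map_XYIdeal (x y : H) :
    (CoordinateRing.XYIdeal E x (C y)).map (conj E) = CoordinateRing.XYIdeal E x (C (E.negY x y)) := by
  have hX : conj E (CoordinateRing.XClass E x) = CoordinateRing.XClass E x := conj_algebraMap _
  have hY : conj E (CoordinateRing.YClass E (C y))
      = -CoordinateRing.YClass E (C (E.negY x y))
        - CoordinateRing.mk E (C (C E.a₁)) * CoordinateRing.XClass E x := by
    have h1 : conj E (CoordinateRing.YClass E (C y))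
        = CoordinateRing.mk E E.negPolynomial - CoordinateRing.mk E (C (C y)) := by
      rw [CoordinateRing.YClass, map_sub, map_sub, conj_Y]
      congr 1
      exact conj_algebraMap _
    rw [h1, CoordinateRing.YClass, CoordinateRing.XClass, ← map_sub, ← map_mul, ← map_neg,
      ← map_sub, negPolynomial, negY]
    congr 1
    simp only [C_neg, C_add, C_sub, C_mul]
    ring
  rw [CoordinateRing.XYIdeal, CoordinateRing.XYIdeal, Ideal.map_span, Set.image_pair, hX, hY]
  apply le_antisymm
  · rw [Ideal.span_le, Set.insert_subset_iff, Set.singleton_subset_iff]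
    have h1 : CoordinateRing.XClass E x ∈ Ideal.span
      {CoordinateRing.XClass E x, CoordinateRing.YClass E (C (E.negY x y))} :=
      Ideal.subset_span (by simp)
    have h2 : CoordinateRing.YClass E (C (E.negY x y)) ∈ Ideal.span
      {CoordinateRing.XClass E x, CoordinateRing.YClass E (C (E.negY x y))} :=
      Ideal.subset_span (by simp)
    exact ⟨h1, sub_mem (neg_mem h2) (Ideal.mul_mem_left _ _ h1)⟩
  · rw [Ideal.span_le, Set.insert_subset_iff, Set.singleton_subset_iff]
    refine ⟨Ideal.subset_span (by simp), ?_⟩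
    rw [SetLike.mem_coe, Ideal.mem_span_pair]
    exact ⟨-CoordinateRing.mk E (C (C E.a₁)), -1, by ring⟩

/-- The ideal `I` and its conjugate have product generated by the monic polynomial `p`. -/
def HasNorm (I : Ideal E.CoordinateRing) (p : H[X]) : Prop :=
  p.Monic ∧ I * I.map (conj E) = Ideal.span {algebraMap H[X] E.CoordinateRing p}

theorem hasNorm_one : HasNorm (1 : Ideal E.CoordinateRing) 1 :=
  ⟨monic_one, by rw [Ideal.one_eq_top, Ideal.map_top, Ideal.mul_top, map_one, Ideal.span_singleton_one]⟩

theorem HasNorm.mul {I J : Ideal E.CoordinateRing} {p q : H[X]} (h : HasNorm I p)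
    (h' : HasNorm J q) : HasNorm (I * J) (p * q) :=
  ⟨h.1.mul h'.1, by
    rw [Ideal.map_mul, mul_mul_mul_comm, h.2, h'.2, Ideal.span_singleton_mul_span_singleton,
      map_mul]⟩

/-- The coordinate ring is free over `H[t]` with 1 in the basis, so a quotient can be compared in
its first coordinate. -/
theorem algebraMap_dvd_algebraMap {p q : H[X]} :
    algebraMap H[X] E.CoordinateRing p ∣ algebraMap H[X] E.CoordinateRing q ↔ p ∣ q := by
  refine ⟨fun ⟨b, hb⟩ => ?_, map_dvd _⟩
  obtain ⟨r, s, rfl⟩ := CoordinateRing.exists_smul_basis_eq b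
  have := congrArg (fun z => (CoordinateRing.basis E).repr z 0) hb
  simp only [← Algebra.smul_def, map_smul, Finsupp.smul_apply, (repr_smul_basis r s).1,
    smul_eq_mul] at this
  have h1 := (repr_smul_basis (E := E) q 0).1
  rw [zero_smul, add_zero, Algebra.smul_def, mul_one] at h1
  exact ⟨r, h1.symm.trans this⟩

theorem algebraMap_injective : Function.Injective (algebraMap H[X] E.CoordinateRing) :=
  FaithfulSMul.algebraMap_injective _ _

theorem HasNorm.dvd {I : Ideal E.CoordinateRing} {p : H[X]} (h : HasNorm I p)
    {a : E.CoordinateRing} (ha : a ∈ I) : p ∣ Algebra.norm H[X] a := by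
  rw [← algebraMap_dvd_algebraMap (E := E), ← Ideal.mem_span_singleton, ← h.2, algebraMap_norm]
  exact Ideal.mul_mem_mul ha (Ideal.mem_map_of_mem _ ha)

theorem HasNorm.natDegree_le {I : Ideal E.CoordinateRing} {p : H[X]} (h : HasNorm I p)
    {a : E.CoordinateRing} (ha : a ∈ I) (h0 : a ≠ 0) : p.natDegree ≤ poleOrder a :=
  natDegree_le_of_dvd (h.dvd ha) (norm_ne_zero h0)

/-- An element of least possible pole order has the same norm as the ideal, up to a unit. For `b` in
`I` the product of `b` with the conjugate of `a` lies in `(p) = (N a)`; cancelling the conjugate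
shows that `a` divides `b`. -/
theorem HasNorm.span_eq {I : Ideal E.CoordinateRing} {p : H[X]} (h : HasNorm I p)
    {a : E.CoordinateRing} (ha : a ∈ I) (h0 : a ≠ 0) (hd : poleOrder a = p.natDegree) :
    Ideal.span {a} = I := by
  have hass : Algebra.norm H[X] a ∣ p := by
    obtain ⟨r, hr⟩ := h.dvd ha
    have hn := norm_ne_zero h0
    have hr0 : r ≠ 0 := by rintro rfl; exact hn (by rw [hr, mul_zero])
    have : r.natDegree = 0 := by
      have := congrArg natDegree hr
      rw [natDegree_mul h.1.ne_zero hr0] at this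
      rw [poleOrder] at hd
      omega
    obtain ⟨c, rfl⟩ := natDegree_eq_zero.mp this
    have hc : c ≠ 0 := by rintro rfl; simp at hr0
    exact ⟨C c⁻¹, by rw [hr, mul_assoc, ← C_mul, mul_inv_cancel₀ hc, C_1, mul_one]⟩
  refine le_antisymm ((Ideal.span_singleton_le_iff_mem _).mpr ha) fun b hb => ?_
  have hσ : conj E a ≠ 0 := by
    intro hz
    apply norm_ne_zero h0
    apply algebraMap_injective (E := E)
    rw [algebraMap_norm, hz, mul_zero, map_zero]
  have hmem : b * conj E a ∈ I * I.map (conj E) :=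
    Ideal.mul_mem_mul hb (Ideal.mem_map_of_mem _ ha)
  rw [h.2, Ideal.mem_span_singleton] at hmem
  have := (algebraMap_dvd_algebraMap (E := E).mpr hass).trans hmem
  rw [algebraMap_norm, mul_dvd_mul_iff_right hσ] at this
  exact Ideal.mem_span_singleton.mpr this

theorem HasNorm.poleOrder_eq {p : H[X]} {a : E.CoordinateRing}
    (h : HasNorm (Ideal.span {a}) p) : poleOrder a = p.natDegree := by
  have h2 := h.2
  rw [Ideal.map_span, Set.image_singleton, Ideal.span_singleton_mul_span_singleton,
    ← algebraMap_norm, Ideal.span_singleton_eq_span_singleton] at h2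
  have h3 : Associated (Algebra.norm H[X] a) p :=
    associated_of_dvd_dvd (algebraMap_dvd_algebraMap.mp h2.dvd)
      (algebraMap_dvd_algebraMap.mp h2.symm.dvd)
  exact natDegree_eq_of_degree_eq (degree_eq_degree_of_associated h3)

/-- The ideal of functions vanishing at a rational point. -/
def pointIntegralIdeal : E.Point → Ideal E.CoordinateRing
  | .zero => 1
  | .some x y _ => CoordinateRing.XYIdeal E x (C y)

/-- The polynomial `t - t(P)`, or `1` if `P` is the point at infinity. -/
def pointPoly : E.Point → H[X]
  | .zero => 1
  | .some x _ _ => X - C x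

theorem pointPoly_neg (P : E.Point) : pointPoly (-P) = pointPoly P := by
  cases P <;> rfl

theorem coe_pointIdeal (P : E.Point) :
    (pointIdeal P : FractionalIdeal E.CoordinateRing⁰ E.FunctionField) = pointIntegralIdeal P := by
  cases P with
  | zero => simp [pointIdeal, pointIntegralIdeal]
  | some x y h => exact CoordinateRing.XYIdeal'_eq h

theorem conj_map_pointIntegralIdeal (P : E.Point) :
    (pointIntegralIdeal P).map (conj E) = pointIntegralIdeal (-P) := by
  cases P with
  | zero =>
    change (1 : Ideal E.CoordinateRing).map (conj E) = 1
    rw [Ideal.one_eq_top, Ideal.map_top]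
  | some x y h => exact conj_map_XYIdeal x y

theorem pointIntegralIdeal_mul_neg (P : E.Point) :
    pointIntegralIdeal P * pointIntegralIdeal (-P)
      = Ideal.span {algebraMap H[X] E.CoordinateRing (pointPoly P)} := by
  cases P with
  | zero =>
    change (1 : Ideal E.CoordinateRing) * 1 = Ideal.span {algebraMap H[X] _ 1}
    rw [map_one, Ideal.span_singleton_one, one_mul, Ideal.one_eq_top]
  | some x y h =>
    rw [mul_comm]
    exact CoordinateRing.XYIdeal_neg_mul h

theorem monic_pointPoly (P : E.Point) : (pointPoly P).Monic := by
  cases P with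
  | zero => exact monic_one
  | some x y h => exact monic_X_sub_C x

theorem hasNorm_pointIntegralIdeal (P : E.Point) :
    HasNorm (pointIntegralIdeal P) (pointPoly P) :=
  ⟨monic_pointPoly P, by rw [conj_map_pointIntegralIdeal, pointIntegralIdeal_mul_neg]⟩

/-- The invertible fractional ideal `u` has degree `d`. -/
def HasDegree (u : (FractionalIdeal E.CoordinateRing⁰ E.FunctionField)ˣ) (d : ℤ) : Prop :=
  ∃ (I : Ideal E.CoordinateRing) (p : H[X]) (c : E.CoordinateRing), HasNorm I p ∧ c ≠ 0 ∧
    (u : FractionalIdeal E.CoordinateRing⁰ E.FunctionField)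
      * FractionalIdeal.spanSingleton E.CoordinateRing⁰
        (algebraMap E.CoordinateRing E.FunctionField c) = I ∧
    (p.natDegree : ℤ) - poleOrder c = d

theorem hasDegree_one : HasDegree (1 : (FractionalIdeal E.CoordinateRing⁰ E.FunctionField)ˣ) 0 :=
  ⟨1, 1, 1, hasNorm_one, one_ne_zero, by simp, by simp [poleOrder]⟩

theorem HasDegree.mul {u v : (FractionalIdeal E.CoordinateRing⁰ E.FunctionField)ˣ} {d e : ℤ}
    (hu : HasDegree u d) (hv : HasDegree v e) : HasDegree (u * v) (d + e) := by
  obtain ⟨I, p, c, hI, hc, h, hd⟩ := hu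
  obtain ⟨J, q, b, hJ, hb, h', he⟩ := hv
  refine ⟨I * J, p * q, c * b, hI.mul hJ, mul_ne_zero hc hb, ?_, ?_⟩
  · rw [FractionalIdeal.coeIdeal_mul, ← h, ← h', Units.val_mul, map_mul,
      ← FractionalIdeal.spanSingleton_mul_spanSingleton]
    exact mul_mul_mul_comm _ _ _ _
  · rw [poleOrder_mul hc hb, natDegree_mul hI.1.ne_zero hJ.1.ne_zero]
    push_cast
    omega

theorem hasDegree_pointIdeal (P : E.Point) :
    HasDegree (pointIdeal P) (pointPoly P).natDegree :=
  ⟨pointIntegralIdeal P, pointPoly P, 1, hasNorm_pointIntegralIdeal P, one_ne_zero,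
    by simp [coe_pointIdeal], by simp [poleOrder]⟩

/-- The function `t - t(P)` vanishes at `P` and `-P`. It therefore clears the denominator of the
inverse ideal and leaves the ideal of `-P`; the degree is `1 - 2 = -1` at a finite point. -/
theorem hasDegree_pointIdeal_inv (P : E.Point) :
    HasDegree (pointIdeal P)⁻¹ (-(pointPoly P).natDegree) := by
  refine ⟨pointIntegralIdeal (-P), pointPoly (-P), algebraMap H[X] _ (pointPoly P),
    hasNorm_pointIntegralIdeal _, ?_, ?_, ?_⟩
  · rw [Ne, FaithfulSMul.algebraMap_eq_zero_iff]
    exact (monic_pointPoly P).ne_zero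
  · rw [Units.inv_mul_eq_iff_eq_mul, ← FractionalIdeal.coeIdeal_span_singleton,
      ← pointIntegralIdeal_mul_neg, FractionalIdeal.coeIdeal_mul, coe_pointIdeal]
  · rw [poleOrder, pointPoly_neg,
      Algebra.norm_algebraMap_of_basis (CoordinateRing.basis E), natDegree_pow, Fintype.card_fin]
    push_cast
    ring

theorem HasDegree.pow {u : (FractionalIdeal E.CoordinateRing⁰ E.FunctionField)ˣ} {d : ℤ}
    (hu : HasDegree u d) (n : ℕ) : HasDegree (u ^ n) (n * d) := by
  induction n with
  | zero => simpa using hasDegree_one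
  | succ n ih =>
    rw [pow_succ]
    convert! ih.mul hu using 1
    push_cast; ring

theorem hasDegree_pointIdeal_zpow (P : E.Point) (k : ℤ) :
    HasDegree (pointIdeal P ^ k) (k * (pointPoly P).natDegree) := by
  obtain ⟨n, rfl | rfl⟩ := k.eq_nat_or_neg
  · simpa using (hasDegree_pointIdeal P).pow n
  · rw [zpow_neg, zpow_natCast, ← inv_pow]
    convert! (hasDegree_pointIdeal_inv P).pow n using 1
    ring

/-- The fractional ideal of the affine part of a divisor. -/
def divisorIdeal (D : E.Point →₀ ℤ) : (FractionalIdeal E.CoordinateRing⁰ E.FunctionField)ˣ :=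
  D.prod fun P k => pointIdeal P ^ k

/-- The degree of the affine part of a divisor. -/
def affineDegree (D : E.Point →₀ ℤ) : ℤ :=
  D.sum fun P k => k * (pointPoly P).natDegree

theorem hasDegree_divisorIdeal (D : E.Point →₀ ℤ) :
    HasDegree (divisorIdeal D) (affineDegree D) := by
  unfold divisorIdeal affineDegree
  induction D using Finsupp.induction with
  | zero => simpa using hasDegree_one
  | single_add P k D hP hk ih =>
    classical
    rw [Finsupp.prod_add_index' (by simp) (by simp [zpow_add]),
      Finsupp.sum_add_index' (by simp) (by intros; ring), Finsupp.prod_single_index (by simp),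
      Finsupp.sum_single_index (by simp)]
    exact (hasDegree_pointIdeal_zpow P k).mul ih

/-- The product formula as an inequality: the pole order at infinity is at least the degree of the
affine divisor imposed. After clearing denominators this is divisibility of norms, and equality
leaves no room for further zeros. -/
theorem HasDegree.le {u : (FractionalIdeal E.CoordinateRing⁰ E.FunctionField)ˣ} {d e : ℤ} {k : H}
    (hu : HasDegree u d) {g : E.FunctionField}
    (hg : g ∈ (u : FractionalIdeal E.CoordinateRing⁰ E.FunctionField))
    (h : HasLeadingTerm g e k) : d ≤ e ∧ (d = e →
      FractionalIdeal.spanSingleton E.CoordinateRing⁰ g = u) := by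
  obtain ⟨I, p, c, hI, hc, hu, rfl⟩ := hu
  have hmem : g * algebraMap E.CoordinateRing E.FunctionField c
      ∈ (I : FractionalIdeal E.CoordinateRing⁰ E.FunctionField) := by
    rw [← hu]
    exact FractionalIdeal.mul_mem_mul hg (FractionalIdeal.mem_spanSingleton_self _ _)
  rw [FractionalIdeal.mem_coeIdeal] at hmem
  obtain ⟨a, ha, hac⟩ := hmem
  have hc1 : algebraMap E.CoordinateRing E.FunctionField c ≠ 0 := by
    simpa [FaithfulSMul.algebraMap_eq_zero_iff] using hc
  have ha0 : a ≠ 0 := by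
    rintro rfl
    rw [map_zero, eq_comm, mul_eq_zero] at hac
    exact hac.elim h.ne_zero hc1
  have he := (h.unique ⟨a, c, ha0, hc, hac.symm, rfl,
    (div_mul_cancel₀ _ (leadCoeff_ne_zero hc)).symm⟩).1
  have hle := hI.natDegree_le ha ha0
  refine ⟨by omega, fun hde => ?_⟩
  have hs := hI.span_eq ha ha0 (by omega)
  have hcu : FractionalIdeal.spanSingleton E.CoordinateRing⁰
        (algebraMap E.CoordinateRing E.FunctionField c)
      * FractionalIdeal.spanSingleton E.CoordinateRing⁰
        (algebraMap E.CoordinateRing E.FunctionField c)⁻¹ = 1 := by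
    rw [FractionalIdeal.spanSingleton_mul_spanSingleton, mul_inv_cancel₀ hc1,
      FractionalIdeal.spanSingleton_one]
  rw [← hs, FractionalIdeal.coeIdeal_span_singleton, hac,
    ← FractionalIdeal.spanSingleton_mul_spanSingleton] at hu
  have := congrArg (· * FractionalIdeal.spanSingleton E.CoordinateRing⁰
        (algebraMap E.CoordinateRing E.FunctionField c)⁻¹) hu
  simp only [mul_assoc, hcu, mul_one] at this
  exact this.symm

theorem HasDegree.eq {u : (FractionalIdeal E.CoordinateRing⁰ E.FunctionField)ˣ} {d e : ℤ} {k : H}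
    (hu : HasDegree u d) {g : E.FunctionField}
    (hg : FractionalIdeal.spanSingleton E.CoordinateRing⁰ g = u)
    (h : HasLeadingTerm g e k) : e = d := by
  obtain ⟨I, p, c, hI, hc, hu, rfl⟩ := hu
  rw [← hg, FractionalIdeal.spanSingleton_mul_spanSingleton] at hu
  have hmem : g * algebraMap E.CoordinateRing E.FunctionField c
      ∈ (I : FractionalIdeal E.CoordinateRing⁰ E.FunctionField) := by
    rw [← hu]
    exact FractionalIdeal.mem_spanSingleton_self _ _
  rw [FractionalIdeal.mem_coeIdeal] at hmem
  obtain ⟨a, ha, hac⟩ := hmem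
  have hc1 : algebraMap E.CoordinateRing E.FunctionField c ≠ 0 := by
    simpa [FaithfulSMul.algebraMap_eq_zero_iff] using hc
  have ha0 : a ≠ 0 := by
    rintro rfl
    rw [map_zero, eq_comm, mul_eq_zero] at hac
    exact hac.elim h.ne_zero hc1
  have he := (h.unique ⟨a, c, ha0, hc, hac.symm, rfl,
    (div_mul_cancel₀ _ (leadCoeff_ne_zero hc)).symm⟩).1
  rw [← hac, ← FractionalIdeal.coeIdeal_span_singleton, FractionalIdeal.coeIdeal_inj] at hu
  rw [← hu] at hI
  rw [he, hI.poleOrder_eq]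

theorem mk_pointIdeal [DecidableEq H] (P : E.Point) :
    ClassGroup.mk E.FunctionField (pointIdeal P) = (Point.toClass P).toMul := by
  cases P with
  | zero => exact map_one _
  | some x y h => rfl

/-- Passing from points to ideal classes is additive, so the class of a divisor depends only on the
sum of its points in the group law. -/
theorem mk_divisorIdeal [DecidableEq H] (D : E.Point →₀ ℤ) :
    ClassGroup.mk E.FunctionField (divisorIdeal D)
      = (Point.toClass (D.sum fun P k => k • P)).toMul := by
  rw [divisorIdeal, map_finsuppProd, map_finsuppSum, Finsupp.prod, Finsupp.sum, toMul_sum]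
  exact Finset.prod_congr rfl fun P _ => by
    rw [map_zpow, mk_pointIdeal, map_zsmul, toMul_zsmul]

theorem sum_eq_zero_of_span [DecidableEq H] {D : E.Point →₀ ℤ} {g : E.FunctionField}
    (h : FractionalIdeal.spanSingleton E.CoordinateRing⁰ g = divisorIdeal D) :
    (D.sum fun P k => k • P) = 0 := by
  apply Point.toClass_injective
  rw [map_zero]
  have := mk_divisorIdeal D
  rw [(ClassGroup.mk_eq_one_iff (K := E.FunctionField)).mpr] at this
  · exact this.symm
  · rw [← h]
    rw [FractionalIdeal.coe_spanSingleton]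
    exact ⟨g, rfl⟩

theorem sum_eq_zero_of_poleLE [DecidableEq H] {D : E.Point →₀ ℤ} {g : E.FunctionField}
    (h0 : g ≠ 0) (hg : g ∈ (divisorIdeal D : FractionalIdeal E.CoordinateRing⁰ E.FunctionField))
    (hd : PoleLE g (affineDegree D)) : (D.sum fun P k => k • P) = 0 := by
  obtain ⟨e, c, he⟩ := exists_hasLeadingTerm h0
  obtain ⟨h1, h2⟩ := (hasDegree_divisorIdeal D).le hg he
  exact sum_eq_zero_of_span (h2 (le_antisymm h1 (hd _ _ he)))

/-- The vanishing sum makes the affine ideal principal. Its generator has pole order `affineDegree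
D`, so the total degree being 0 gives the prescribed order at infinity, which `affineDegree` does
not count. -/
theorem exists_hasDivisor [DecidableEq H] {D : E.Point →₀ ℤ} (hdeg : affineDegree D = -D 0)
    (hsum : (D.sum fun P k => k • P) = 0) :
    ∃ g : E.FunctionField, HasDivisor g D ∧ HasSignOne g := by
  have hcl := mk_divisorIdeal D
  rw [hsum, map_zero] at hcl
  have hp := (ClassGroup.mk_eq_one_iff (K := E.FunctionField)).mp hcl
  obtain ⟨g, hg⟩ := (FractionalIdeal.isPrincipal_iff _).mp hp
  have hg0 : g ≠ 0 := by
    rintro rfl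
    rw [FractionalIdeal.spanSingleton_zero] at hg
    exact (divisorIdeal D).ne_zero hg
  obtain ⟨e, c, he⟩ := exists_hasLeadingTerm hg0
  have hc := he.coeff_ne_zero
  have hed := (hasDegree_divisorIdeal D).eq hg.symm he
  have hs := he.smul (inv_ne_zero hc)
  rw [inv_mul_cancel₀ hc] at hs
  -- Dividing by the leading coefficient normalizes the sign without changing the ideal.
  refine ⟨c⁻¹ • g, ⟨?_, 1, by rwa [← hdeg, ← hed]⟩, _, hs⟩
  refine Eq.trans ?_ hg.symm
  apply le_antisymm
  · rw [FractionalIdeal.spanSingleton_le_iff_mem, FractionalIdeal.mem_spanSingleton]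
    exact ⟨algebraMap H _ c⁻¹, by rw [algebraMap_smul]⟩
  · rw [FractionalIdeal.spanSingleton_le_iff_mem, FractionalIdeal.mem_spanSingleton]
    exact ⟨algebraMap H _ c, by rw [algebraMap_smul, smul_inv_smul₀ hc]⟩

theorem HasDivisor.hasLeadingTerm {D : E.Point →₀ ℤ} {g : E.FunctionField} (h : HasDivisor g D)
    (h1 : HasSignOne g) : HasLeadingTerm g (-D 0) 1 := by
  obtain ⟨-, c, hc⟩ := h
  obtain ⟨d, hd⟩ := h1
  rwa [(hd.unique hc).1] at hd

theorem eq_algebraMap_of_poleOrder {r : E.CoordinateRing} (h : poleOrder r = 0) :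
    ∃ c, r = algebraMap H E.CoordinateRing c := by
  rw [← natDegree_weightPoly] at h
  obtain ⟨c, hc⟩ := natDegree_eq_zero.mp h
  refine ⟨c, sub_eq_zero.mp (weightPoly_eq_zero.mp ?_)⟩
  have := weightPoly_apply (E := E) (C c) 0
  rw [zero_smul, add_zero, Algebra.smul_def, mul_one] at this
  rw [map_sub, ← hc, IsScalarTower.algebraMap_apply H H[X], Polynomial.algebraMap_apply,
    Algebra.algebraMap_self_apply, this]
  simp

/-- The quotient of the two functions is regular on the affine curve and has pole order 0, hence is
constant; comparing signs shows that the constant is 1. -/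
theorem HasDivisor.eq {D : E.Point →₀ ℤ} {g g' : E.FunctionField} (h : HasDivisor g D)
    (h1 : HasSignOne g) (h' : HasDivisor g' D) (h1' : HasSignOne g') : g = g' := by
  have hl := h.hasLeadingTerm h1
  have hl' := h'.hasLeadingTerm h1'
  have hmem : g ∈ FractionalIdeal.spanSingleton E.CoordinateRing⁰ g' := by
    rw [h'.1, ← h.1]
    exact FractionalIdeal.mem_spanSingleton_self _ _
  obtain ⟨r, rfl⟩ := (FractionalIdeal.mem_spanSingleton _).mp hmem
  rw [Algebra.smul_def] at hl ⊢
  have hr0 : r ≠ 0 := by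
    rintro rfl
    exact hl.ne_zero (by simp)
  obtain ⟨hd, hc⟩ := hl.unique ((hasLeadingTerm_algebraMap hr0).mul hl')
  obtain ⟨c, rfl⟩ := eq_algebraMap_of_poleOrder (r := r) (by omega)
  rw [← IsScalarTower.algebraMap_apply, ← Algebra.smul_def]
  have hk : c ≠ 0 := by rintro rfl; simp at hr0
  rw [← IsScalarTower.algebraMap_apply, ← Algebra.smul_def] at hl
  have := (hl.unique (hl'.smul hk)).2
  rw [mul_one] at this
  rw [← this, one_smul]

theorem HasDivisor.mem {D : E.Point →₀ ℤ} {g : E.FunctionField} (h : HasDivisor g D) :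
    g ∈ (divisorIdeal D : FractionalIdeal E.CoordinateRing⁰ E.FunctionField) := by
  rw [divisorIdeal, ← h.1]
  exact FractionalIdeal.mem_spanSingleton_self _ _

end Divisors

end

end AndersonTensor

namespace AndersonTensor

noncomputable section

open WeierstrassCurve.Affine

/-! ### The duplication formula for abscissas -/

section Duplication

theorem addX_self_mul {H : Type*} [Field H] [DecidableEq H] {E : WeierstrassCurve.Affine H}
    {x y : H} (h : E.Equation x y) (hy : y ≠ E.negY x y) :
    E.addX x x (E.slope x x y y) * (4 * x ^ 3 + E.b₂ * x ^ 2 + 2 * E.b₄ * x + E.b₆)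
      = x ^ 4 - E.b₄ * x ^ 2 - 2 * E.b₆ * x - E.b₈ := by
  have heq := (equation_iff x y).mp h
  have hd : y - E.negY x y ≠ 0 := sub_ne_zero.mpr hy
  rw [slope_of_Y_ne rfl hy, addX]
  -- On the curve the denominator is the square `(2y + a₁x + a₃)²`, which is the square of the
  -- denominator of the tangent slope.
  have hD : (4 * x ^ 3 + E.b₂ * x ^ 2 + 2 * E.b₄ * x + E.b₆) = (y - E.negY x y) ^ 2 := by
    simp only [WeierstrassCurve.b₂, WeierstrassCurve.b₄, WeierstrassCurve.b₆, negY]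
    linear_combination (-4) * heq
  rw [hD]
  field_simp
  simp only [WeierstrassCurve.b₄, WeierstrassCurve.b₆, WeierstrassCurve.b₈, negY]
  linear_combination (8 * x + E.a₁ ^ 2 + 4 * E.a₂) * (-heq)

variable {F : Type*} [Field F] (W : WeierstrassCurve F)

/-- The numerator of the duplication formula. -/
def dupNum : F[X] := X ^ 4 - C W.b₄ * X ^ 2 - C (2 * W.b₆) * X - C W.b₈

/-- The denominator of the duplication formula. -/
def dupDenom : F[X] := C 4 * X ^ 3 + C W.b₂ * X ^ 2 + C (2 * W.b₄) * X + C W.b₆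

theorem natDegree_dupNum : (dupNum W).natDegree = 4 := by
  unfold dupNum
  compute_degree!

/-- An explicit Bézout identity with value `Δ`, valid in every characteristic, in which `b_relation`
eliminates `b₈`. -/
theorem isCoprime_dup [W.IsElliptic] : IsCoprime (dupNum W) (dupDenom W) := by
  have key : (C (-48) * X ^ 2 - C (8 * W.b₂) * X + C (W.b₂ ^ 2 - 32 * W.b₄)) * dupNum W
      + (C 12 * X ^ 3 - C W.b₂ * X ^ 2 - C (10 * W.b₄) * X + C (W.b₂ * W.b₄ - 27 * W.b₆))
        * dupDenom W = C W.Δ := by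
    have hb : C (4 * W.b₈) = C (W.b₂ * W.b₆ - W.b₄ ^ 2) := congrArg C W.b_relation
    rw [WeierstrassCurve.Δ]
    simp only [dupNum, dupDenom, C_mul, C_sub, C_add, C_pow, C_neg, map_ofNat] at hb ⊢
    linear_combination (12 * X ^ 2 + 2 * C W.b₂ * X + 8 * C W.b₄) * hb
  have hΔ : W.Δ ≠ 0 := W.isUnit_Δ.ne_zero
  have h1 : C W.Δ⁻¹ * C W.Δ = 1 := by rw [← C_mul, inv_mul_cancel₀ hΔ, C_1]
  rw [← key, mul_add, ← mul_assoc, ← mul_assoc] at h1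
  exact ⟨_, _, h1⟩

theorem dupDenom_ne_zero [W.IsElliptic] : dupDenom W ≠ 0 := by
  intro h
  have := isCoprime_dup W
  rw [h, isCoprime_zero_right] at this
  have := natDegree_eq_zero_of_isUnit this
  rw [natDegree_dupNum] at this
  omega

end Duplication

/-! ### Points with transcendental abscissa are not torsion -/

section Transcendence

open IntermediateField

variable {F : Type*} [Field F] {H : Type*} [Field H] [Algebra F H]

/-- Since `x` is transcendental, `F(x)` is the rational function field and `x'` corresponds to `f =
p/q`. If `x` lay in `F(x')`, then `f` would generate the whole field and have degree 1; but
coprimality puts `p`, of degree above 1, into the numerator of `f`. -/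
theorem notMem_adjoin_of_coprime {p q : F[X]} (hpq : IsCoprime p q) (hp : 1 < p.natDegree)
    {x x' : H} (hx : Transcendental F x) (h : x' * aeval x q = aeval x p) (hq : q ≠ 0) :
    x ∉ F⟮x'⟯ := by
  have hinj : Function.Injective (aeval x : F[X] →ₐ[F] H) :=
    transcendental_iff_injective.mp hx
  let φ : RatFunc F →ₐ[F] H := RatFunc.liftAlgHom (aeval x)
    (nonZeroDivisors_le_comap_nonZeroDivisors_of_injective _ hinj)
  let f : RatFunc F := algebraMap F[X] (RatFunc F) p / algebraMap F[X] (RatFunc F) q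
  have hφ (r : F[X]) : φ (algebraMap F[X] (RatFunc F) r) = aeval x r := by
    have := RatFunc.liftAlgHom_apply_div' (φ := (aeval x : F[X] →ₐ[F] H))
      (hφ := nonZeroDivisors_le_comap_nonZeroDivisors_of_injective _ hinj) r 1
    simpa using this
  have hqx : aeval x q ≠ 0 := by
    rw [← map_zero (aeval x : F[X] →ₐ[F] H)]
    exact hinj.ne hq
  have hφf : φ f = x' := by
    rw [show φ f = aeval x p / aeval x q by rw [map_div₀, hφ, hφ], ← h,
      mul_div_cancel_right₀ _ hqx]
  have hφX : φ RatFunc.X = x := by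
    rw [← RatFunc.algebraMap_X, hφ, aeval_X]
  intro hmem
  have hmap : F⟮x'⟯ = F⟮f⟯.map φ := by
    rw [adjoin_map, Set.image_singleton, hφf]
  rw [hmap] at hmem
  obtain ⟨g, hg, hgx⟩ := hmem
  have : g = RatFunc.X := φ.toRingHom.injective (hgx.trans hφX.symm)
  rw [this] at hg
  have htop : F⟮f⟯ = ⊤ := by
    rw [eq_top_iff, ← RatFunc.adjoin_X, adjoin_simple_le_iff]
    exact hg
  have hrank := RatFunc.finrank_eq_max_natDegree f
  rw [htop, IntermediateField.finrank_top] at hrank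
  have hdvd : p ∣ f.num := by
    apply hpq.dvd_of_dvd_mul_right
    refine ⟨f.denom, ?_⟩
    apply IsFractionRing.injective F[X] (RatFunc F)
    have hden : algebraMap F[X] (RatFunc F) f.denom ≠ 0 :=
      (map_ne_zero_iff _ (IsFractionRing.injective F[X] (RatFunc F))).mpr f.denom_ne_zero
    have hq0 : algebraMap F[X] (RatFunc F) q ≠ 0 :=
      (map_ne_zero_iff _ (IsFractionRing.injective F[X] (RatFunc F))).mpr hq
    have := f.num_div_denom
    rw [map_mul, map_mul, ← div_eq_div_iff hden hq0]
    exact this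
  have hnum : f.num ≠ 0 := by
    rw [Ne, RatFunc.num_eq_zero_iff]
    intro h0
    rw [h0, map_zero] at hφf
    rw [← hφf, zero_mul, eq_comm, ← map_zero (aeval x : F[X] →ₐ[F] H)] at h
    have := hinj h
    rw [this, natDegree_zero] at hp
    omega
  have := natDegree_le_of_dvd hdvd hnum
  omega

theorem mem_adjoin_of_mul_eq {p q : F[X]} {x x' : H} (hx : Transcendental F x)
    (h : x' * aeval x q = aeval x p) (hq : q ≠ 0) : x' ∈ F⟮x⟯ := by
  have hqx : aeval x q ≠ 0 := (transcendental_iff.mp hx q).mt hq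
  rw [eq_div_iff hqx |>.mpr h]
  have hm (r : F[X]) : aeval x r ∈ F⟮x⟯ :=
    algebra_adjoin_le_adjoin F {x} (aeval_mem_adjoin_singleton F x)
  exact div_mem (hm p) (hm q)

/-- If `x'` were algebraic, then `x` would be algebraic as well, being a root of `p - x' q`. This
polynomial is nonzero because `p` and `q` are coprime and `p` is not constant. -/
theorem transcendental_of_mul_eq {p q : F[X]} (hpq : IsCoprime p q) (hp : 0 < p.natDegree)
    {x x' : H} (hx : Transcendental F x) (h : x' * aeval x q = aeval x p) :
    Transcendental F x' := by
  intro halg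
  apply hx
  have halg' : Algebra.IsAlgebraic F F⟮x'⟯ := isAlgebraic_adjoin_simple halg.isIntegral
  have hx' : IsAlgebraic F⟮x'⟯ x := by
    let r : F⟮x'⟯[X] := p.map (algebraMap F F⟮x'⟯)
      - C (AdjoinSimple.gen F x') * q.map (algebraMap F F⟮x'⟯)
    refine ⟨r, ?_, ?_⟩
    · intro hr
      have hpq' := hpq.map (mapRingHom (algebraMap F F⟮x'⟯))
      simp only [coe_mapRingHom] at hpq'
      rw [sub_eq_zero.mp hr] at hpq'
      have hu := natDegree_eq_zero_of_isUnit (isCoprime_self.mp hpq'.of_mul_left_right)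
      have h1 := congrArg natDegree (sub_eq_zero.mp hr)
      have h2 := natDegree_C_mul_le (AdjoinSimple.gen F x') (q.map (algebraMap F F⟮x'⟯))
      rw [natDegree_map] at h1
      omega
    · simp only [r, map_sub, map_mul, aeval_map_algebraMap, aeval_C]
      rw [← h]
      simp
  exact hx'.restrictScalars F

variable [DecidableEq H] {W : WeierstrassCurve.Affine F} [W.IsElliptic]

theorem exists_add_self {x y : H} (h : (W⁄H).toAffine.Nonsingular x y)
    (hx : Transcendental F x) : ∃ x' y', ∃ h' : (W⁄H).toAffine.Nonsingular x' y',
      Point.some x y h + Point.some x y h = Point.some x' y' h' ∧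
        x' * aeval x (dupDenom W) = aeval x (dupNum W) := by
  have hD : aeval x (dupDenom W) = 4 * x ^ 3 + (W⁄H).b₂ * x ^ 2 + 2 * (W⁄H).b₄ * x + (W⁄H).b₆ := by
    rw [show (W⁄H).b₂ = algebraMap F H W.b₂ from W.map_b₂ _,
      show (W⁄H).b₄ = algebraMap F H W.b₄ from W.map_b₄ _,
      show (W⁄H).b₆ = algebraMap F H W.b₆ from W.map_b₆ _]
    simp only [dupDenom, map_add, map_mul, aeval_C, aeval_X, map_pow, map_ofNat]
  have hN : aeval x (dupNum W)
      = x ^ 4 - (W⁄H).b₄ * x ^ 2 - 2 * (W⁄H).b₆ * x - (W⁄H).b₈ := by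
    rw [show (W⁄H).b₈ = algebraMap F H W.b₈ from W.map_b₈ _,
      show (W⁄H).b₄ = algebraMap F H W.b₄ from W.map_b₄ _,
      show (W⁄H).b₆ = algebraMap F H W.b₆ from W.map_b₆ _]
    simp only [dupNum, map_sub, map_mul, aeval_C, aeval_X, map_pow, map_ofNat]
  -- A point of order 2 has an abscissa that is a root of the duplication denominator, hence
  -- algebraic.
  have hy : y ≠ (W⁄H).toAffine.negY x y := by
    intro hy
    apply (transcendental_iff.mp hx _).mt (dupDenom_ne_zero W)
    have heq := (equation_iff x y).mp h.1
    rw [hD]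
    simp only [WeierstrassCurve.b₂, WeierstrassCurve.b₄, WeierstrassCurve.b₆]
    have hs : 2 * y + (W⁄H).a₁ * x + (W⁄H).a₃ = 0 := by
      rw [negY] at hy
      linear_combination hy
    linear_combination (-4) * heq + (2 * y + (W⁄H).a₁ * x + (W⁄H).a₃) * hs
  refine ⟨_, _, _, Point.add_self_of_Y_ne hy, ?_⟩
  rw [hD, hN]
  exact addX_self_mul h.1 hy

theorem exists_two_pow_smul (k : ℕ) {x y : H} (h : (W⁄H).toAffine.Nonsingular x y)
    (hx : Transcendental F x) : ∃ x' y', ∃ h' : (W⁄H).toAffine.Nonsingular x' y',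
      2 ^ k • Point.some x y h = Point.some x' y' h' ∧ Transcendental F x' ∧ x' ∈ F⟮x⟯ := by
  induction k with
  | zero => exact ⟨x, y, h, by simp, hx, mem_adjoin_simple_self F x⟩
  | succ k ih =>
    obtain ⟨x₁, y₁, h₁, he, ht, hm⟩ := ih
    obtain ⟨x₂, y₂, h₂, he₂, hd⟩ := exists_add_self h₁ ht
    refine ⟨x₂, y₂, h₂, by rw [pow_succ, mul_nsmul, he, two_nsmul, he₂],
      transcendental_of_mul_eq (isCoprime_dup W) (by rw [natDegree_dupNum]; omega) ht hd, ?_⟩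
    exact (adjoin_simple_le_iff.mpr hm) (mem_adjoin_of_mul_eq ht hd (dupDenom_ne_zero W))

/-- Every further doubling of `2P` has its abscissa in `F(x(2P))`, and this field does not contain
`x(P)`. -/
theorem two_pow_smul_ne_self (k : ℕ) {x y : H} (h : (W⁄H).toAffine.Nonsingular x y)
    (hx : Transcendental F x) : 2 ^ (k + 1) • Point.some x y h ≠ Point.some x y h := by
  intro hk
  obtain ⟨x₁, y₁, h₁, he₁, hd⟩ := exists_add_self h hx
  obtain ⟨x₂, y₂, h₂, he₂, -, hm⟩ := exists_two_pow_smul k h₁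
    (transcendental_of_mul_eq (isCoprime_dup W) (by rw [natDegree_dupNum]; omega) hx hd)
  rw [pow_succ', mul_nsmul, two_nsmul, he₁, he₂, Point.some.injEq] at hk
  rw [hk.1] at hm
  exact notMem_adjoin_of_coprime (isCoprime_dup W) (by rw [natDegree_dupNum]; omega) hx hd
    (dupDenom_ne_zero W) hm

theorem nsmul_ne_zero_of_transcendental {x y : H} (h : (W⁄H).toAffine.Nonsingular x y)
    (hx : Transcendental F x) {n : ℕ} (hn : 0 < n) : n • Point.some x y h ≠ 0 := by
  intro h0
  -- Pigeonhole modulo `n`: two powers of 2 agree there, so if `nP = 0` then `2^i P = 2^j P`, and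
  -- the point `2^i P` returns to itself after `j - i` doublings.
  obtain ⟨i, j, hij, he⟩ := Finite.exists_ne_map_eq_of_infinite
    (fun k : ℕ => (⟨2 ^ k % n, Nat.mod_lt _ hn⟩ : Fin n))
  wlog hlt : i < j generalizing i j
  · exact this j i hij.symm he.symm (by omega)
  have he' : 2 ^ i % n = 2 ^ j % n := congrArg Fin.val he
  obtain ⟨x₁, y₁, h₁, he₁, ht, -⟩ := exists_two_pow_smul i h hx
  apply two_pow_smul_ne_self (j - i - 1) h₁ ht
  rw [← he₁, ← mul_nsmul, ← pow_add, nsmul_eq_mod_nsmul _ h0, nsmul_eq_mod_nsmul (2 ^ i) h0, he']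
  congr 3
  omega

end Transcendence

/-! ### The generic point `Ξ` is not torsion -/

section GenericPoint

variable {F : Type*} [Field F] (W : WeierstrassCurve.Affine F)
  (H : Type*) [Field H] [Algebra W.FunctionField H]

theorem iota_injective : Function.Injective (iota W H) :=
  (algebraMap W.FunctionField H).injective.comp (FaithfulSMul.algebraMap_injective _ _)

variable [Algebra F H] [IsScalarTower F W.FunctionField H]

theorem transcendental_thetaElt : Transcendental F (thetaElt W H) := by
  rw [transcendental_iff]
  intro p hp
  have h : aeval (thetaElt W H) p = iota W H (algebraMap F[X] W.CoordinateRing p) := by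
    have : (aeval (thetaElt W H) : F[X] →ₐ[F] H).toRingHom
        = (iota W H).comp (algebraMap F[X] W.CoordinateRing) := by
      refine Polynomial.ringHom_ext (fun c => ?_) ?_
      · exact (aeval_C _ c).trans (iota_algebraMap W H c).symm
      · exact aeval_X _
    exact RingHom.congr_fun this p
  rw [h, ← map_zero (iota W H)] at hp
  exact algebraMap_injective ((iota_injective W H hp).trans (map_zero _).symm)

theorem nsmul_Xi_ne_zero [W.IsElliptic] [DecidableEq H] {n : ℕ} (hn : 0 < n) :
    n • Xi W H ≠ 0 :=
  nsmul_ne_zero_of_transcendental _ (transcendental_thetaElt W H) hn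

end GenericPoint

end

end AndersonTensor

namespace AndersonTensor

noncomputable section

open WeierstrassCurve.Affine

/-! ### Additivity of degree, ideal and sum of a divisor -/

section DivisorArithmetic

variable {H : Type*} [Field H] {E : WeierstrassCurve.Affine H}

theorem natDegree_pointPoly {P : E.Point} (hP : P ≠ 0) : (pointPoly P).natDegree = 1 := by
  cases P with
  | zero => exact absurd rfl hP
  | some x y h => exact natDegree_X_sub_C x

theorem natDegree_pointPoly_zero : (pointPoly (0 : E.Point)).natDegree = 0 :=
  natDegree_one

theorem affineDegree_single (P : E.Point) (k : ℤ) :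
    affineDegree (Finsupp.single P k) = k * (pointPoly P).natDegree :=
  Finsupp.sum_single_index (zero_mul _)

theorem affineDegree_add (D D' : E.Point →₀ ℤ) :
    affineDegree (D + D') = affineDegree D + affineDegree D' := by
  classical
  exact Finsupp.sum_add_index' (fun _ => zero_mul _) fun _ _ _ => add_mul _ _ _

theorem affineDegree_sub (D D' : E.Point →₀ ℤ) :
    affineDegree (D - D') = affineDegree D - affineDegree D' :=
  Finsupp.sum_sub_index fun _ _ _ => sub_mul _ _ _

theorem divisorIdeal_single (P : E.Point) (k : ℤ) :
    divisorIdeal (Finsupp.single P k) = pointIdeal P ^ k :=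
  Finsupp.prod_single_index (zpow_zero _)

theorem divisorIdeal_add (D D' : E.Point →₀ ℤ) :
    divisorIdeal (D + D') = divisorIdeal D * divisorIdeal D' := by
  classical
  exact Finsupp.prod_add_index' (fun _ => zpow_zero _) fun _ _ _ => zpow_add _ _ _

theorem divisorIdeal_sub (D D' : E.Point →₀ ℤ) :
    divisorIdeal (D - D') = divisorIdeal D * (divisorIdeal D')⁻¹ := by
  rw [eq_mul_inv_iff_mul_eq, ← divisorIdeal_add, sub_add_cancel]

theorem sum_zsmul_single [DecidableEq H] (P : E.Point) (k : ℤ) :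
    ((Finsupp.single P k).sum fun P k => k • P) = k • P :=
  Finsupp.sum_single_index (zero_smul _ _)

theorem sum_zsmul_add [DecidableEq H] (D D' : E.Point →₀ ℤ) :
    ((D + D').sum fun P k => k • P) = (D.sum fun P k => k • P) + D'.sum fun P k => k • P := by
  classical
  exact Finsupp.sum_add_index' (fun _ => zero_smul _ _) fun _ _ _ => add_smul _ _ _

theorem sum_zsmul_sub [DecidableEq H] (D D' : E.Point →₀ ℤ) :
    ((D - D').sum fun P k => k • P) = (D.sum fun P k => k • P) - D'.sum fun P k => k • P :=
  Finsupp.sum_sub_index fun _ _ _ => sub_smul _ _ _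

theorem mul_pointIdeal_le (u : (FractionalIdeal E.CoordinateRing⁰ E.FunctionField)ˣ)
    (P : E.Point) :
    ((u * pointIdeal P : (FractionalIdeal E.CoordinateRing⁰ E.FunctionField)ˣ) :
      FractionalIdeal E.CoordinateRing⁰ E.FunctionField) ≤ u := by
  rw [Units.val_mul, coe_pointIdeal]
  exact (mul_le_mul_right FractionalIdeal.coeIdeal_le_one _).trans_eq (mul_one _)

/-- Rewrites a bound on poles as an integrality condition, a form that can be carried along a ring
homomorphism. -/
theorem mem_inv_iff (I : Ideal E.CoordinateRing)
    (u : (FractionalIdeal E.CoordinateRing⁰ E.FunctionField)ˣ)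
    (hu : (u : FractionalIdeal E.CoordinateRing⁰ E.FunctionField) = I) (g : E.FunctionField) :
    g ∈ ((u⁻¹ : (FractionalIdeal E.CoordinateRing⁰ E.FunctionField)ˣ) :
        FractionalIdeal E.CoordinateRing⁰ E.FunctionField) ↔
      ∀ a ∈ I, ∃ b, g * algebraMap E.CoordinateRing E.FunctionField a
        = algebraMap E.CoordinateRing E.FunctionField b := by
  constructor
  · intro hg a ha
    have : g * algebraMap E.CoordinateRing E.FunctionField a
        ∈ ((u⁻¹ * u : (FractionalIdeal E.CoordinateRing⁰ E.FunctionField)ˣ) :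
          FractionalIdeal E.CoordinateRing⁰ E.FunctionField) :=
      FractionalIdeal.mul_mem_mul hg (hu ▸ FractionalIdeal.mem_coeIdeal_of_mem _ ha)
    rw [inv_mul_cancel, Units.val_one, FractionalIdeal.mem_one_iff] at this
    obtain ⟨b, hb⟩ := this
    exact ⟨b, hb.symm⟩
  · intro h
    have hle : FractionalIdeal.spanSingleton E.CoordinateRing⁰ g * u ≤ 1 := by
      rw [FractionalIdeal.spanSingleton_mul_le_iff]
      intro z hz
      rw [hu, FractionalIdeal.mem_coeIdeal] at hz
      obtain ⟨a, ha, rfl⟩ := hz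
      obtain ⟨b, hb⟩ := h a ha
      exact (FractionalIdeal.mem_one_iff _).mpr ⟨b, hb.symm⟩
    have h2 := mul_le_mul_left hle ((u⁻¹ : (FractionalIdeal E.CoordinateRing⁰ E.FunctionField)ˣ) :
        FractionalIdeal E.CoordinateRing⁰ E.FunctionField)
    rw [mul_assoc, Units.mul_inv, mul_one, one_mul] at h2
    exact h2 (FractionalIdeal.mem_spanSingleton_self _ _)

theorem algebraMap_mul_mem {u : (FractionalIdeal E.CoordinateRing⁰ E.FunctionField)ˣ}
    {P : E.Point} {a : E.CoordinateRing} (ha : a ∈ pointIntegralIdeal P) {g : E.FunctionField}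
    (hg : g ∈ (u : FractionalIdeal E.CoordinateRing⁰ E.FunctionField)) :
    algebraMap E.CoordinateRing E.FunctionField a * g
      ∈ ((u * pointIdeal P : (FractionalIdeal E.CoordinateRing⁰ E.FunctionField)ˣ) :
        FractionalIdeal E.CoordinateRing⁰ E.FunctionField) := by
  rw [Units.val_mul, mul_comm (algebraMap _ _ a)]
  refine FractionalIdeal.mul_mem_mul hg ?_
  rw [coe_pointIdeal]
  exact FractionalIdeal.mem_coeIdeal_of_mem _ ha

theorem smul_mem_fractionalIdeal {u : FractionalIdeal E.CoordinateRing⁰ E.FunctionField}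
    {g : E.FunctionField} (hg : g ∈ u) (c : H) : c • g ∈ u := by
  rw [← algebraMap_smul E.CoordinateRing c g]
  exact (u : Submodule E.CoordinateRing E.FunctionField).smul_mem _ hg

theorem hasLeadingTerm_tCoord : HasLeadingTerm
    (algebraMap E.CoordinateRing E.FunctionField (tCoord E)) 2 1 := by
  have h : weightPoly (tCoord E) = X ^ 2 := by
    have := weightPoly_apply (E := E) X 0
    rw [zero_smul, add_zero, Algebra.smul_def, mul_one] at this
    exact this.trans (by simp)
  have h0 : tCoord E ≠ 0 := by
    rw [Ne, ← weightPoly_eq_zero, h]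
    exact pow_ne_zero 2 X_ne_zero
  have := hasLeadingTerm_algebraMap h0
  rwa [← natDegree_weightPoly, ← leadingCoeff_weightPoly, h, natDegree_X_pow,
    leadingCoeff_X_pow] at this

theorem hasLeadingTerm_yCoord : HasLeadingTerm
    (algebraMap E.CoordinateRing E.FunctionField (yCoord E)) 3 1 := by
  have h : weightPoly (yCoord E) = X ^ 3 := by
    have := weightPoly_apply (E := E) 0 1
    rw [zero_smul, zero_add, one_smul] at this
    exact this.trans (by simp)
  have h0 : yCoord E ≠ 0 := by
    rw [Ne, ← weightPoly_eq_zero, h]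
    exact pow_ne_zero 3 X_ne_zero
  have := hasLeadingTerm_algebraMap h0
  rwa [← natDegree_weightPoly, ← leadingCoeff_weightPoly, h, natDegree_X_pow,
    leadingCoeff_X_pow] at this

theorem HasLeadingTerm.sub_smul {h h' : E.FunctionField} {d e : ℤ} {c c' : H}
    (hh : HasLeadingTerm h d c) (hh' : HasLeadingTerm h' e c') (hde : e < d) (k : H) :
    HasLeadingTerm (h - k • h') d c := by
  rw [sub_eq_add_neg, ← neg_smul]
  exact hh.add_poleLE ((hh'.poleLE.smul _).mono (by omega))

end DivisorArithmetic

/-! ### Effect of the Frobenius twist on leading terms and on poles -/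

section TwistLemmas

variable {F : Type*} [Field F] [Fintype F] (W : WeierstrassCurve.Affine F)
  (H : Type*) [Field H] [Algebra F H]

theorem twistRing_smul_basis (p q : H[X]) :
    twistRing W H (p • 1 + q • CoordinateRing.mk _ Y)
      = p.map (frob F H) • 1 + q.map (frob F H) • CoordinateRing.mk _ Y := by
  rw [CoordinateRing.smul, CoordinateRing.smul, CoordinateRing.smul, CoordinateRing.smul, mul_one,
    mul_one, map_add, map_mul, twistRing_mk, twistRing_mk, twistRing_mk, map_C, map_C, map_X]
  rfl

theorem weightPoly_twistRing (a : (W⁄H).toAffine.CoordinateRing) :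
    weightPoly (twistRing W H a) = (weightPoly a).map (frob F H) := by
  obtain ⟨p, q, rfl⟩ := CoordinateRing.exists_smul_basis_eq a
  rw [twistRing_smul_basis, weightPoly_apply, weightPoly_apply]
  simp [Polynomial.map_expand]

theorem twist_algebraMap (a : (W⁄H).toAffine.CoordinateRing) :
    twist W H (algebraMap _ _ a) = algebraMap _ _ (twistRing W H a) := by
  unfold twist IsFractionRing.map
  exact IsLocalization.map_eq _ _

theorem twistRing_algebraMap (c : H) :
    twistRing W H (algebraMap H _ c) = algebraMap H _ (frob F H c) := by
  refine (twistRing_mk W H (C (C c))).trans ?_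
  rw [map_C, coe_mapRingHom, map_C]
  rfl

theorem twist_smul (c : H) (g : (W⁄H).toAffine.FunctionField) :
    twist W H (c • g) = frob F H c • twist W H g := by
  rw [← algebraMap_smul (W⁄H).toAffine.CoordinateRing c g, Algebra.smul_def, map_mul,
    twist_algebraMap, twistRing_algebraMap, ← Algebra.smul_def, algebraMap_smul]

theorem twistRing_tCoord : twistRing W H (tCoord _) = tCoord _ := by
  rw [tCoord, twistRing_mk, map_C, coe_mapRingHom, map_X]

theorem twistRing_yCoord : twistRing W H (yCoord _) = yCoord _ := by
  rw [yCoord, twistRing_mk, map_X]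

variable {W H}

theorem HasLeadingTerm.twist {g : (W⁄H).toAffine.FunctionField} {d : ℤ} {c : H}
    (h : HasLeadingTerm g d c) : HasLeadingTerm (twist W H g) d (frob F H c) := by
  obtain ⟨a, b, ha, hb, hg, hd, hc⟩ := h
  have hp (x : (W⁄H).toAffine.CoordinateRing) : poleOrder (twistRing W H x) = poleOrder x := by
    rw [← natDegree_weightPoly, weightPoly_twistRing, natDegree_map, natDegree_weightPoly]
  have hl (x : (W⁄H).toAffine.CoordinateRing) :
      leadCoeff (twistRing W H x) = frob F H (leadCoeff x) := by
    rw [← leadingCoeff_weightPoly, weightPoly_twistRing, leadingCoeff_map, leadingCoeff_weightPoly]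
  have h0 {x : (W⁄H).toAffine.CoordinateRing} (hx : x ≠ 0) : twistRing W H x ≠ 0 :=
    (map_ne_zero_iff _ (twistRing_injective W H)).mpr hx
  refine ⟨twistRing W H a, twistRing W H b, h0 ha, h0 hb, ?_, ?_, ?_⟩
  · rw [← twist_algebraMap, ← twist_algebraMap, ← map_mul, hg]
  · rw [hp, hp, hd]
  · rw [hl, hl, hc, map_mul]

variable [DecidableEq H]

theorem map_twistRing_pointIntegralIdeal (P : WeierstrassCurve.Affine.Point (W⁄H)) :
    (pointIntegralIdeal P).map (twistRing W H) = pointIntegralIdeal (frobPoint P) := by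
  cases P with
  | zero =>
    change Ideal.map _ 1 = 1
    rw [Ideal.one_eq_top, Ideal.map_top]
  | some x y h =>
    change Ideal.map _ (CoordinateRing.XYIdeal _ x (C y))
      = CoordinateRing.XYIdeal _ (frob F H x) (C (frob F H y))
    rw [CoordinateRing.XYIdeal, CoordinateRing.XYIdeal, Ideal.map_span, Set.image_pair,
      CoordinateRing.XClass, CoordinateRing.YClass, twistRing_mk, twistRing_mk]
    simp [CoordinateRing.XClass, CoordinateRing.YClass]

/-- The ideal of `P⁽¹⁾` is generated by the twists of functions vanishing at `P`. Integrality of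
`g⁽¹⁾a` thus needs checking only for twisted `a`, where it is the twist of a known relation. -/
theorem twist_mem_inv {P : WeierstrassCurve.Affine.Point (W⁄H)} {n : ℕ}
    {g : (W⁄H).toAffine.FunctionField}
    (hg : g ∈ (((pointIdeal P ^ n)⁻¹ : (FractionalIdeal _ _)ˣ) :
      FractionalIdeal (W⁄H).toAffine.CoordinateRing⁰ (W⁄H).toAffine.FunctionField)) :
    twist W H g ∈ (((pointIdeal (frobPoint P) ^ n)⁻¹ : (FractionalIdeal _ _)ˣ) :
      FractionalIdeal (W⁄H).toAffine.CoordinateRing⁰ (W⁄H).toAffine.FunctionField) := by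
  have hcoe (Q : WeierstrassCurve.Affine.Point (W⁄H)) :
      ((pointIdeal Q ^ n : (FractionalIdeal _ _)ˣ) :
        FractionalIdeal (W⁄H).toAffine.CoordinateRing⁰ (W⁄H).toAffine.FunctionField)
        = ((pointIntegralIdeal Q ^ n : Ideal _) : FractionalIdeal _ _) := by
    rw [Units.val_pow_eq_pow_val, coe_pointIdeal, FractionalIdeal.coeIdeal_pow]
  rw [mem_inv_iff _ _ (hcoe P)] at hg
  rw [mem_inv_iff _ _ (hcoe _), ← map_twistRing_pointIntegralIdeal, ← Ideal.map_pow]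
  intro a ha
  refine Submodule.span_induction (p := fun a _ => ∃ b, twist W H g * algebraMap _ _ a
    = algebraMap _ _ b) ?_ ⟨0, by simp⟩ ?_ ?_ ha
  · rintro _ ⟨x, hx, rfl⟩
    obtain ⟨b, hb⟩ := hg x hx
    exact ⟨twistRing W H b, by
      rw [← twist_algebraMap, ← twist_algebraMap, ← map_mul, hb]⟩
  · rintro x y - - ⟨b, hb⟩ ⟨c, hc⟩
    exact ⟨b + c, by rw [map_add, mul_add, hb, hc, map_add]⟩
  · rintro r x - ⟨b, hb⟩
    exact ⟨r * b, by rw [smul_eq_mul, map_mul, mul_left_comm, hb, map_mul]⟩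

end TwistLemmas

end

end AndersonTensor

namespace AndersonTensor

noncomputable section

open WeierstrassCurve.Affine

/-! ### The functions `f` and `g_j`, their multiplication relations and the constants -/

section Motive

theorem pow_mul_pow_inv {G : Type*} [CommGroup G] (a b c : G) (n : ℕ) :
    (a * b⁻¹ * c) ^ n * (a ^ n)⁻¹ = (b ^ n)⁻¹ * c ^ n := by
  rw [mul_pow, mul_pow, inv_pow, mul_inv_eq_iff_eq_mul, mul_comm, mul_comm (a ^ n), ← mul_assoc,
    mul_comm (c ^ n)]

variable {F : Type*} [Field F] {W : WeierstrassCurve.Affine F} {H : Type*} [Field H] [Algebra F H]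

theorem const_mul (c : H) (g : (W⁄H).toAffine.FunctionField) : const c * g = c • g := by
  rw [← algebraMap_smul (W⁄H).toAffine.CoordinateRing c g, Algebra.smul_def]

section Extension

variable [Fintype F]

theorem gExt_of_lt (f : (W⁄H).toAffine.FunctionField) {n : ℕ}
    (g : Fin n → (W⁄H).toAffine.FunctionField) (i : Fin n) : gExt f g i = g i := by
  have hi := i.2
  have h0 : 0 < n := by omega
  simp [gExt, h0, Nat.div_eq_of_lt hi, Nat.mod_eq_of_lt hi]

theorem gExt_add (f : (W⁄H).toAffine.FunctionField) {n : ℕ} (hn : 0 < n)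
    (g : Fin n → (W⁄H).toAffine.FunctionField) (m : ℕ) :
    gExt f g (m + n) = tauOp f n (gExt f g m) := by
  simp only [gExt, hn, dif_pos, Nat.add_div_right m hn, Nat.add_mod_right,
    Function.iterate_succ_apply']

end Extension

section Generic

variable [Algebra W.FunctionField H] [IsScalarTower F W.FunctionField H] [W.IsElliptic]

variable (W H) in
theorem Xi_ne_zero : Xi W H ≠ 0 := WeierstrassCurve.Affine.Point.some_ne_zero _

theorem tCoord_sub_mem : tCoord _ - algebraMap H _ (thetaElt W H)
    ∈ pointIntegralIdeal (Xi W H) := by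
  change CoordinateRing.mk _ (C X) - CoordinateRing.mk _ (C (C (thetaElt W H)))
    ∈ CoordinateRing.XYIdeal (W⁄H).toAffine (thetaElt W H) (C (etaElt W H))
  rw [← map_sub, ← C_sub]
  exact Ideal.subset_span (by simp [CoordinateRing.XClass])

theorem yCoord_sub_mem : yCoord _ - algebraMap H _ (etaElt W H)
    ∈ pointIntegralIdeal (Xi W H) := by
  change CoordinateRing.mk _ Y - CoordinateRing.mk _ (C (C (etaElt W H)))
    ∈ CoordinateRing.XYIdeal (W⁄H).toAffine (thetaElt W H) (C (etaElt W H))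
  rw [← map_sub]
  exact Ideal.subset_span (by simp [CoordinateRing.YClass])

section MotiveIdeal

variable {V : WeierstrassCurve.Affine.Point (W⁄H)}

variable (V) in
/-- The fractional ideal of functions with divisor at least `-n (V) + i (Ξ)` on the affine curve. -/
def motiveIdeal (n i : ℕ) :
    FractionalIdeal (W⁄H).toAffine.CoordinateRing⁰ (W⁄H).toAffine.FunctionField :=
  divisorIdeal (Finsupp.single V (-(n : ℤ)) + Finsupp.single (Xi W H) (i : ℤ))

theorem motiveIdeal_eq (n i : ℕ) :
    motiveIdeal V n i = ((pointIdeal V ^ n)⁻¹ * pointIdeal (Xi W H) ^ i :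
      (FractionalIdeal (W⁄H).toAffine.CoordinateRing⁰ (W⁄H).toAffine.FunctionField)ˣ) := by
  rw [motiveIdeal, divisorIdeal_add, divisorIdeal_single, divisorIdeal_single, zpow_neg,
    zpow_natCast, zpow_natCast]

theorem mem_motiveIdeal_of_le {n i j : ℕ} (hij : i ≤ j) {h : (W⁄H).toAffine.FunctionField}
    (hh : h ∈ motiveIdeal V n j) :
    h ∈ motiveIdeal V n i := by
  induction j, hij using Nat.le_induction with
  | base => exact hh
  | succ j _ ih =>
    rw [motiveIdeal_eq, pow_succ, ← mul_assoc] at hh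
    apply ih
    rw [motiveIdeal_eq]
    exact mul_pointIdeal_le _ _ hh

variable {n : ℕ}

theorem sub_const_mul_mem {n i : ℕ} {a : (W⁄H).toAffine.CoordinateRing} {c : H}
    (ha : a - algebraMap H _ c ∈ pointIntegralIdeal (Xi W H))
    {h : (W⁄H).toAffine.FunctionField} (hh : h ∈ motiveIdeal V n i) :
    regular a * h - c • h ∈ motiveIdeal V n (i + 1) := by
  rw [motiveIdeal_eq] at hh
  rw [motiveIdeal_eq, pow_succ, ← mul_assoc, ← const_mul, ← sub_mul, ← map_sub]
  exact algebraMap_mul_mem ha hh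

theorem sub_mem_motiveIdeal {i : ℕ} {h h' : (W⁄H).toAffine.FunctionField}
    (hh : h ∈ motiveIdeal V n i)
    (hh' : h' ∈ motiveIdeal V n i) :
    h - h' ∈ motiveIdeal V n i :=
  (motiveIdeal V n i).1.sub_mem hh hh'

end MotiveIdeal

end Generic

variable [Fintype F] [DecidableEq H]

theorem frobPoint_ne_zero {P : WeierstrassCurve.Affine.Point (W⁄H)} (hP : P ≠ 0) :
    frobPoint P ≠ 0 :=
  (map_ne_zero_iff _ (WeierstrassCurve.Affine.Point.map_injective _)).mpr hP

variable [Algebra W.FunctionField H] [IsScalarTower F W.FunctionField H] [W.IsElliptic]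
  {V : WeierstrassCurve.Affine.Point (W⁄H)}

variable (V) in
/-- The divisor `(V⁽¹⁾) - (V) + (Ξ) - (∞)`. -/
abbrev shtukaDivisor : WeierstrassCurve.Affine.Point (W⁄H) →₀ ℤ :=
  Finsupp.single (frobPoint V) 1 - Finsupp.single V 1
      + Finsupp.single (Xi W H) 1 - Finsupp.single 0 1

variable (V) in
/-- The divisor of the function with index `i`. -/
abbrev tauBasisDivisor (n i : ℕ) : WeierstrassCurve.Affine.Point (W⁄H) →₀ ℤ :=
  Finsupp.single V (-(n : ℤ)) + Finsupp.single 0 ((n : ℤ) - (i + 1))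
        + Finsupp.single (Xi W H) (i : ℤ) + Finsupp.single (i • frobPoint V + (n - i) • V) 1

section Shtuka

variable (hV : V - frobPoint V = Xi W H)
include hV

theorem ne_zero_of_sub_frobPoint : V ≠ 0 := by
  rintro rfl
  rw [map_zero, sub_zero] at hV
  exact Xi_ne_zero W H hV.symm

/-- If `nV = 0`, applying Frobenius gives `nV⁽¹⁾ = 0`, hence `nΞ = 0`. -/
theorem nsmul_ne_zero_of_sub_frobPoint {n : ℕ} (hn : 0 < n) : n • V ≠ 0 := by
  intro h
  apply nsmul_Xi_ne_zero W H hn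
  rw [← hV, nsmul_sub, ← map_nsmul, h, map_zero, sub_zero]

theorem shtukaDivisor_apply_zero : shtukaDivisor V 0 = -1 := by
  have h0 := ne_zero_of_sub_frobPoint hV
  simp [shtukaDivisor, h0, frobPoint_ne_zero h0, Xi_ne_zero W H]

theorem existsUnique_shtuka :
    ∃! f : (W⁄H).toAffine.FunctionField, IsShtukaFunction V f := by
  have h0 := ne_zero_of_sub_frobPoint hV
  obtain ⟨f, hf⟩ := exists_hasDivisor (D := shtukaDivisor V) (by
    rw [shtukaDivisor_apply_zero hV]
    simp only [shtukaDivisor, affineDegree_add, affineDegree_sub, affineDegree_single, natDegree_pointPoly h0,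
      natDegree_pointPoly (frobPoint_ne_zero h0), natDegree_pointPoly (Xi_ne_zero W H),
      natDegree_pointPoly_zero]
    norm_num) (by
    simp only [shtukaDivisor, sum_zsmul_add, sum_zsmul_sub, sum_zsmul_single, ← hV]
    simp)
  exact ⟨f, hf, fun f' hf' => hf'.1.eq hf'.2 hf.1 hf.2⟩

theorem IsShtukaFunction.hasLeadingTerm {f : (W⁄H).toAffine.FunctionField}
    (hf : IsShtukaFunction V f) : HasLeadingTerm f 1 1 := by
  have := hf.1.hasLeadingTerm hf.2
  rwa [shtukaDivisor_apply_zero hV, neg_neg] at this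

variable {n : ℕ} (hVn : ∀ j : ℕ, 0 < j → j < n → j • frobPoint V + (n - j) • V ≠ 0)
include hVn

theorem residualPoint_ne_zero {i : ℕ} (hi : i ≤ n) (hn : 0 < n) :
    i • frobPoint V + (n - i) • V ≠ 0 := by
  rcases i.eq_zero_or_pos with rfl | h0
  · simpa using nsmul_ne_zero_of_sub_frobPoint hV hn
  rcases hi.lt_or_eq with h | rfl
  · exact hVn i h0 h
  · rw [Nat.sub_self, zero_nsmul, add_zero, ← map_nsmul]
    exact frobPoint_ne_zero (nsmul_ne_zero_of_sub_frobPoint hV hn)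

/-- None of `V`, `Ξ` and the residual point is the point at infinity, so only the explicit summand
at infinity counts. For the residual point this is the assumption on `[j]V⁽¹⁾ + [n-j]V`. -/
theorem tauBasisDivisor_apply_zero (i : Fin n) :
    tauBasisDivisor V n i 0
      = (n : ℤ) - ((i : ℕ) + 1) := by
  have h0 := ne_zero_of_sub_frobPoint hV
  have hP := residualPoint_ne_zero hV hVn i.2.le i.pos
  rw [tauBasisDivisor, Finsupp.add_apply, Finsupp.add_apply, Finsupp.add_apply, Finsupp.single_eq_of_ne h0.symm,
    Finsupp.single_eq_same, Finsupp.single_eq_of_ne (Xi_ne_zero W H).symm,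
    Finsupp.single_eq_of_ne hP.symm]
  ring

/-- The degree is `-n + (n-i-1) + i + 1 = 0`, and `-nV + i(V - V⁽¹⁾) + iV⁽¹⁾ + (n-i)V = 0`. -/
theorem existsUnique_tauBasis :
    ∃! g : Fin n → (W⁄H).toAffine.FunctionField, IsTauBasis V n g := by
  have h0 := ne_zero_of_sub_frobPoint hV
  have (i : Fin n) := exists_hasDivisor (D := tauBasisDivisor V n i) (by
    rw [tauBasisDivisor_apply_zero hV hVn]
    simp only [tauBasisDivisor, affineDegree_add, affineDegree_single, natDegree_pointPoly h0,
      natDegree_pointPoly (residualPoint_ne_zero hV hVn i.2.le i.pos),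
      natDegree_pointPoly (Xi_ne_zero W H), natDegree_pointPoly_zero]
    push_cast
    ring) (by
    simp only [tauBasisDivisor, sum_zsmul_add, sum_zsmul_single, ← hV, one_smul, natCast_zsmul, neg_smul,
      smul_zero, nsmul_sub]
    nth_rw 1 [show n = (n - (i : ℕ)) + i by omega]
    rw [add_nsmul]
    abel)
  choose g hg using this
  exact ⟨g, hg, fun g' hg' => funext fun i => (hg' i).1.eq (hg' i).2 (hg i).1 (hg i).2⟩

variable {f : (W⁄H).toAffine.FunctionField} {g : Fin n → (W⁄H).toAffine.FunctionField}

/-- The index `m` function has pole order `m + 1 - n` at infinity and sign `1`. -/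
theorem hasLeadingTerm_gExt (hn : 0 < n) (hf : IsShtukaFunction V f) (hg : IsTauBasis V n g)
    (m : ℕ) : HasLeadingTerm (gExt f g m) ((m : ℤ) + 1 - n) 1 := by
  induction m using Nat.strong_induction_on with
  | _ m ih =>
    by_cases hm : m < n
    · have := (hg ⟨m, hm⟩).1.hasLeadingTerm (hg ⟨m, hm⟩).2
      rw [tauBasisDivisor_apply_zero hV hVn] at this
      rw [gExt_of_lt f g ⟨m, hm⟩]
      convert! this using 1
      ring
    · obtain ⟨k, rfl⟩ := Nat.exists_eq_add_of_le' (not_lt.mp hm)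
      rw [gExt_add f hn, tauOp]
      -- `f` has a simple pole at infinity, so `τ` raises the pole order by `n`; the sign 1 is fixed
      -- by Frobenius.
      convert! ((hf.hasLeadingTerm hV).pow n).mul (ih k (by omega)).twist using 1
      · push_cast; ring
      · simp

end Shtuka

theorem divisorIdeal_shtukaDivisor : divisorIdeal (shtukaDivisor V)
    = pointIdeal (frobPoint V) * (pointIdeal V)⁻¹ * pointIdeal (Xi W H) := by
  have h1 : (pointIdeal (0 : WeierstrassCurve.Affine.Point (W⁄H))) = 1 := rfl
  rw [shtukaDivisor, divisorIdeal_sub, divisorIdeal_add, divisorIdeal_sub, divisorIdeal_single,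
    divisorIdeal_single, divisorIdeal_single, divisorIdeal_single, zpow_one, zpow_one, zpow_one,
    zpow_one, h1, inv_one, mul_one]

/-- Twisting moves the poles of `h` from `V` to `V⁽¹⁾`. The factor `f^n` cancels them there, creates
poles of order `n` at `V` again, and adds `n` zeros at `Ξ`. -/
theorem tauOp_mem_motiveIdeal {n : ℕ} {f h : (W⁄H).toAffine.FunctionField}
    (hf : IsShtukaFunction V f) (hh : h ∈ motiveIdeal V n 0) :
    tauOp f n h ∈ motiveIdeal V n n := by
  have hf' : f ^ n ∈ ((divisorIdeal (shtukaDivisor V) ^ n : (FractionalIdeal _ _)ˣ) :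
      FractionalIdeal (W⁄H).toAffine.CoordinateRing⁰ (W⁄H).toAffine.FunctionField) := by
    rw [Units.val_pow_eq_pow_val, divisorIdeal, ← hf.1.1, FractionalIdeal.spanSingleton_pow]
    exact FractionalIdeal.mem_spanSingleton_self _ _
  rw [motiveIdeal_eq, pow_zero, mul_one] at hh
  have h2 := FractionalIdeal.mul_mem_mul hf' (twist_mem_inv hh)
  rw [← Units.val_mul, divisorIdeal_shtukaDivisor, pow_mul_pow_inv] at h2
  rw [motiveIdeal_eq]
  exact h2

theorem gExt_mem_motiveIdeal {n : ℕ} {f : (W⁄H).toAffine.FunctionField}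
    {g : Fin n → (W⁄H).toAffine.FunctionField} (hn : 0 < n) (hf : IsShtukaFunction V f)
    (hg : IsTauBasis V n g) (m : ℕ) :
    gExt f g m ∈ motiveIdeal V n (min m n) := by
  induction m using Nat.strong_induction_on with
  | _ m ih =>
    by_cases hm : m < n
    · have := (hg ⟨m, hm⟩).1.mem
      rw [gExt_of_lt f g ⟨m, hm⟩, min_eq_left hm.le]
      have h1 : (pointIdeal (0 : WeierstrassCurve.Affine.Point (W⁄H))) = 1 := rfl
      rw [divisorIdeal_add, divisorIdeal_single _ 1, zpow_one] at this
      -- The residual zero is discarded; the point at infinity contributes the unit ideal.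
      have := mul_pointIdeal_le _ _ this
      rwa [divisorIdeal_add, divisorIdeal_add, divisorIdeal_single 0, h1, one_zpow, mul_one,
        ← divisorIdeal_add] at this
    · obtain ⟨k, rfl⟩ := Nat.exists_eq_add_of_le' (not_lt.mp hm)
      rw [gExt_add f hn, min_eq_right (by omega)]
      exact tauOp_mem_motiveIdeal hf (mem_motiveIdeal_of_le (Nat.zero_le _) (ih k (by omega)))

/-- The bound is the degree `i - n` of `-n(V) + i(Ξ)`. A nonzero `r` would make this divisor's
points sum to zero, but their sum is minus the residual point `[i]V⁽¹⁾ + [n-i]V`. -/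
theorem eq_zero_of_mem_motiveIdeal (hV : V - frobPoint V = Xi W H) {n i : ℕ}
    (hVn : ∀ j : ℕ, 0 < j → j < n → j • frobPoint V + (n - j) • V ≠ 0) (hn : 0 < n) (hi : i ≤ n)
    {r : (W⁄H).toAffine.FunctionField}
    (hr : r ∈ motiveIdeal V n i) (hp : PoleLE r ((i : ℤ) - n)) :
    r = 0 := by
  by_contra h
  have h0 := ne_zero_of_sub_frobPoint hV
  have := sum_eq_zero_of_poleLE h hr (by
    simpa only [affineDegree_add, affineDegree_single, natDegree_pointPoly h0,
      natDegree_pointPoly (Xi_ne_zero W H), Nat.cast_one, mul_one, neg_add_eq_sub] using hp)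
  apply residualPoint_ne_zero hV hVn hi hn
  simp only [sum_zsmul_add, sum_zsmul_single, neg_smul, natCast_zsmul, ← hV, nsmul_sub] at this
  nth_rw 1 [show n = (n - i) + i by omega] at this
  rw [add_nsmul] at this
  rw [← neg_eq_zero, ← this]
  abel

variable {n : ℕ} {f : (W⁄H).toAffine.FunctionField} {g : Fin n → (W⁄H).toAffine.FunctionField}

theorem linearIndependent_gExt (hV : V - frobPoint V = Xi W H)
    (hVn : ∀ j : ℕ, 0 < j → j < n → j • frobPoint V + (n - j) • V ≠ 0) (hn : 0 < n)
    (hf : IsShtukaFunction V f) (hg : IsTauBasis V n g) : LinearIndependent H (gExt f g) :=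
  linearIndependent_of_strictMono_pole _ (fun m => (m : ℤ) + 1 - n)
    (fun a b hab => by simp only; omega)
    fun m => ⟨1, hasLeadingTerm_gExt hV hVn hn hf hg m⟩

theorem exists_t_relation (hV : V - frobPoint V = Xi W H)
    (hVn : ∀ j : ℕ, 0 < j → j < n → j • frobPoint V + (n - j) • V ≠ 0) (hn : 0 < n)
    (hf : IsShtukaFunction V f) (hg : IsTauBasis V n g) {i : ℕ} (hi : i < n) :
    ∃ a : H, regular (tCoord _) * gExt f g i
        = thetaElt W H • gExt f g i + a • gExt f g (i + 1) + gExt f g (i + 2) := by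
  have hl := hasLeadingTerm_gExt hV hVn hn hf hg
  have hm (k : ℕ) (hk : i + 1 ≤ k) :
      gExt f g k ∈ motiveIdeal V n (i + 1) :=
    mem_motiveIdeal_of_le (by omega) (gExt_mem_motiveIdeal hn hf hg k)
  have h1 := (hasLeadingTerm_tCoord.mul (hl i)).sub_smul (hl i) (by omega) (thetaElt W H)
  rw [one_mul] at h1
  have h2 := hl (i + 2)
  rw [show ((i + 2 : ℕ) : ℤ) + 1 - n = 2 + ((i : ℤ) + 1 - n) by push_cast; ring] at h2
  -- Subtracting `gExt f g (i + 2)` removes the leading term, and `a` is chosen to remove the next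
  -- one. What remains has pole order at most `i + 1 - n`, just what the vanishing criterion
  -- requires.
  obtain ⟨a, ha⟩ := (h1.sub_poleLE h2).exists_sub_smul (g' := gExt f g (i + 1)) (by
    convert! hl (i + 1) using 1
    push_cast; ring)
  refine ⟨a, ?_⟩
  have h0 := mem_motiveIdeal_of_le (V := V) (n := n) (i := i) (by omega)
    (gExt_mem_motiveIdeal hn hf hg i)
  have := eq_zero_of_mem_motiveIdeal hV hVn hn (show i + 1 ≤ n by omega)
    (sub_mem_motiveIdeal (sub_mem_motiveIdeal (sub_const_mul_mem tCoord_sub_mem h0)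
      (hm (i + 2) (by omega))) (smul_mem_fractionalIdeal (hm (i + 1) le_rfl) a))
    (ha.mono (by push_cast; omega))
  linear_combination this

theorem exists_y_relation (hV : V - frobPoint V = Xi W H)
    (hVn : ∀ j : ℕ, 0 < j → j < n → j • frobPoint V + (n - j) • V ≠ 0) (hn : 0 < n)
    (hf : IsShtukaFunction V f) (hg : IsTauBasis V n g) {i : ℕ} (hi : i < n) :
    ∃ b c : H, regular (yCoord _) * gExt f g i
        = etaElt W H • gExt f g i + b • gExt f g (i + 1) + c • gExt f g (i + 2)
          + gExt f g (i + 3) := by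
  have hl := hasLeadingTerm_gExt hV hVn hn hf hg
  have hm (k : ℕ) (hk : i + 1 ≤ k) :
      gExt f g k ∈ motiveIdeal V n (i + 1) :=
    mem_motiveIdeal_of_le (by omega) (gExt_mem_motiveIdeal hn hf hg k)
  have h1 := (hasLeadingTerm_yCoord.mul (hl i)).sub_smul (hl i) (by omega) (etaElt W H)
  rw [one_mul] at h1
  have h2 := hl (i + 3)
  rw [show ((i + 3 : ℕ) : ℤ) + 1 - n = 3 + ((i : ℤ) + 1 - n) by push_cast; ring] at h2
  -- As `y` has pole order 3, there are two intermediate pole orders to clear, the higher one first.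
  obtain ⟨c, hc⟩ := (h1.sub_poleLE h2).exists_sub_smul (g' := gExt f g (i + 2)) (by
    convert! hl (i + 2) using 1
    push_cast; ring)
  obtain ⟨b, hb⟩ := hc.exists_sub_smul (g' := gExt f g (i + 1)) (by
    convert! hl (i + 1) using 1
    push_cast; ring)
  refine ⟨b, c, ?_⟩
  have h0 := mem_motiveIdeal_of_le (V := V) (n := n) (i := i) (by omega)
    (gExt_mem_motiveIdeal hn hf hg i)
  have := eq_zero_of_mem_motiveIdeal hV hVn hn (show i + 1 ≤ n by omega)
    (sub_mem_motiveIdeal (sub_mem_motiveIdeal (sub_mem_motiveIdeal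
      (sub_const_mul_mem yCoord_sub_mem h0)
      (hm (i + 3) (by omega))) (smul_mem_fractionalIdeal (hm (i + 2) (by omega)) c))
      (smul_mem_fractionalIdeal (hm (i + 1) le_rfl) b))
    (hb.mono (by push_cast; omega))
  linear_combination this

theorem existsUnique_structureConstants (hV : V - frobPoint V = Xi W H)
    (hVn : ∀ j : ℕ, 0 < j → j < n → j • frobPoint V + (n - j) • V ≠ 0) (hn : 0 < n)
    (hf : IsShtukaFunction V f) (hg : IsTauBasis V n g) :
    ∃! c : (Fin n → H) × (Fin n → H) × (Fin n → H),
        AreStructureConstants f g c.1 c.2.1 c.2.2 := by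
  choose a ha using fun i : Fin n => exists_t_relation hV hVn hn hf hg i.2
  choose b c hbc using fun i : Fin n => exists_y_relation hV hVn hn hf hg i.2
  refine ⟨(a, b, c), fun i => ?_, ?_⟩
  · simp only [const_mul]
    exact ⟨ha i, hbc i⟩
  · rintro ⟨a', b', c'⟩ h'
    have hli := linearIndependent_gExt hV hVn hn hf hg
    simp only [AreStructureConstants, const_mul] at h'
    have hA (i : Fin n) : a' i = a i := by
      have h1 := (h' i).1
      rw [ha i] at h1
      have h2 : (a' i - a i) • gExt f g ((i : ℕ) + 1) = 0 := by
        rw [sub_smul]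
        linear_combination -h1
      exact sub_eq_zero.mp ((smul_eq_zero.mp h2).resolve_right (hli.ne_zero _))
    have hBC (i : Fin n) : b' i = b i ∧ c' i = c i := by
      have h1 := (h' i).2
      rw [hbc i] at h1
      have h2 : (b' i - b i) • gExt f g ((i : ℕ) + 1) + (c' i - c i) • gExt f g ((i : ℕ) + 2)
          = 0 := by
        rw [sub_smul, sub_smul]
        linear_combination -h1
      have h4 := hli.comp ![(i : ℕ) + 1, (i : ℕ) + 2] (by
        intro u v; fin_cases u <;> fin_cases v <;> simp)
      rw [show gExt f g ∘ ![(i : ℕ) + 1, (i : ℕ) + 2]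
        = ![gExt f g ((i : ℕ) + 1), gExt f g ((i : ℕ) + 2)] by ext k; fin_cases k <;> rfl] at h4
      have h3 := LinearIndependent.pair_iff.mp h4 _ _ h2
      exact ⟨sub_eq_zero.mp h3.1, sub_eq_zero.mp h3.2⟩
    rw [Prod.mk.injEq, Prod.mk.injEq]
    exact ⟨funext hA, funext fun i => (hBC i).1, funext fun i => (hBC i).2⟩

end Motive

end

end AndersonTensor

namespace AndersonTensor

noncomputable section

open WeierstrassCurve.Affine

/-! ### Generators of the coordinate ring and their invariance under the twist -/

section Generators

variable {F : Type*} [Field F] (W : WeierstrassCurve.Affine F)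

theorem adjoin_tCoord_yCoord : Algebra.adjoin F {tCoord W, yCoord W} = ⊤ := by
  rw [eq_top_iff]
  rintro a -
  obtain ⟨p, q, rfl⟩ := CoordinateRing.exists_smul_basis_eq a
  have ht : tCoord W ∈ Algebra.adjoin F {tCoord W, yCoord W} := Algebra.subset_adjoin (by simp)
  have hy : yCoord W ∈ Algebra.adjoin F {tCoord W, yCoord W} := Algebra.subset_adjoin (by simp)
  have hp (p : F[X]) : algebraMap F[X] W.CoordinateRing p
      ∈ Algebra.adjoin F {tCoord W, yCoord W} := by
    have : aeval (tCoord W) p = algebraMap F[X] W.CoordinateRing p := by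
      conv_rhs => rw [← aeval_X_left_apply p]
      exact aeval_algebraMap_apply W.CoordinateRing (X : F[X]) p
    rw [← this]
    have hsub : ({tCoord W} : Set W.CoordinateRing) ⊆ {tCoord W, yCoord W} := by simp
    exact Algebra.adjoin_mono hsub (aeval_mem_adjoin_singleton F (tCoord W))
  rw [Algebra.smul_def, Algebra.smul_def, mul_one]
  exact add_mem (hp p) (mul_mem (hp q) hy)

/-- The inclusion of the coordinate ring over `F` in the coordinate ring over `H`. -/
def coordExt (H : Type*) [Field H] [Algebra F H] :
    W.CoordinateRing →+* (W⁄H).toAffine.CoordinateRing :=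
  CoordinateRing.map W (algebraMap F H)

/-- The inclusion of the coordinate ring over `F` in the function field over `H`. -/
def scalarExt (H : Type*) [Field H] [Algebra F H] :
    W.CoordinateRing →+* (W⁄H).toAffine.FunctionField :=
  (algebraMap (W⁄H).toAffine.CoordinateRing _).comp (coordExt W H)

variable (H : Type*) [Field H] [Algebra F H]

theorem coordExt_mk (x : F[X][Y]) : coordExt W H (CoordinateRing.mk W x)
    = CoordinateRing.mk (W⁄H).toAffine (x.map (mapRingHom (algebraMap F H))) :=
  CoordinateRing.map_mk _ _

theorem scalarExt_tCoord : scalarExt W H (tCoord W) = regular (tCoord _) := by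
  rw [scalarExt, RingHom.comp_apply, tCoord, coordExt_mk, map_C, coe_mapRingHom, map_X]
  rfl

theorem scalarExt_yCoord : scalarExt W H (yCoord W) = regular (yCoord _) := by
  rw [scalarExt, RingHom.comp_apply, yCoord, coordExt_mk, map_X]
  rfl

theorem coordExt_algebraMap (c : F) : coordExt W H (algebraMap F W.CoordinateRing c)
    = algebraMap H (W⁄H).toAffine.CoordinateRing (algebraMap F H c) := by
  have h := coordExt_mk W H (C (C c))
  rw [map_C, coe_mapRingHom, map_C] at h
  exact h

theorem scalarExt_algebraMap (c : F) :
    scalarExt W H (algebraMap F W.CoordinateRing c) = const (algebraMap F H c) := by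
  rw [scalarExt, RingHom.comp_apply, coordExt_algebraMap]

theorem twist_scalarExt [Fintype F] (b : W.CoordinateRing) :
    twist W H (scalarExt W H b) = scalarExt W H b := by
  have h : b ∈ Algebra.adjoin F {tCoord W, yCoord W} := by
    rw [adjoin_tCoord_yCoord]; trivial
  induction h using Algebra.adjoin_induction with
  | mem x hx =>
    rcases hx with rfl | rfl
    · rw [scalarExt_tCoord, twist_algebraMap, twistRing_tCoord]
    · rw [scalarExt_yCoord, twist_algebraMap, twistRing_yCoord]
  | algebraMap c =>
    rw [scalarExt_algebraMap, twist_algebraMap, twistRing_algebraMap]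
    congr 2
    exact (FiniteField.frobeniusAlgHom F H).commutes c
  | add x y _ _ hx hy => rw [map_add, map_add, hx, hy]
  | mul x y _ _ hx hy => rw [map_mul, map_mul, hx, hy]

end Generators

/-! ### Twisted polynomials acting on vectors of functions -/

section Action

variable {F : Type*} [Field F] {W : WeierstrassCurve.Affine F} {H : Type*} [Field H] [Algebra F H]
  {n : ℕ}

/-- The action of matrices over `H` on column vectors of rational functions. -/
def matAct (M : TwMatrix F H n) (v : Fin n → (W⁄H).toAffine.FunctionField) :
    Fin n → (W⁄H).toAffine.FunctionField :=
  fun i => ∑ j, (M : Matrix (Fin n) (Fin n) H) i j • v j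

theorem matAct_zero_left (v : Fin n → (W⁄H).toAffine.FunctionField) :
    matAct (0 : TwMatrix F H n) v = 0 := by
  ext i
  exact Finset.sum_eq_zero fun j _ => zero_smul H (v j)

theorem matAct_add_left (M N : TwMatrix F H n) (v : Fin n → (W⁄H).toAffine.FunctionField) :
    matAct (M + N) v = matAct M v + matAct N v := by
  ext i
  exact (Finset.sum_congr rfl fun j _ => add_smul _ _ _).trans Finset.sum_add_distrib

theorem matAct_add_right (M : TwMatrix F H n) (v w : Fin n → (W⁄H).toAffine.FunctionField) :
    matAct M (v + w) = matAct M v + matAct M w := by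
  ext i
  exact (Finset.sum_congr rfl fun j _ => smul_add _ _ _).trans Finset.sum_add_distrib

theorem matAct_mul (M N : TwMatrix F H n) (v : Fin n → (W⁄H).toAffine.FunctionField) :
    matAct (M * N) v = matAct M (matAct N v) := by
  ext i
  have h (A B : Matrix (Fin n) (Fin n) H) (j : Fin n) :
      (A * B) i j • v j = ∑ k, A i k • B k j • v j := by
    rw [Matrix.mul_apply, Finset.sum_smul]
    simp only [mul_smul]
  simp only [matAct, Finset.smul_sum]
  exact (Finset.sum_congr rfl fun j _ => h M N j).trans Finset.sum_comm

theorem matAct_smul (M : TwMatrix F H n) (b : (W⁄H).toAffine.FunctionField)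
    (v : Fin n → (W⁄H).toAffine.FunctionField) : matAct M (b • v) = b • matAct M v := by
  ext i
  simp only [matAct, Pi.smul_apply, Finset.smul_sum, smul_comm b]

variable [Fintype F] (f : (W⁄H).toAffine.FunctionField)

/-- The operator `τ` on column vectors. -/
def tauVec (n : ℕ) (v : Fin n → (W⁄H).toAffine.FunctionField) :
    Fin n → (W⁄H).toAffine.FunctionField :=
  fun i => tauOp f n (v i)

theorem tauVec_add (v w : Fin n → (W⁄H).toAffine.FunctionField) :
    tauVec f n (v + w) = tauVec f n v + tauVec f n w := by
  ext i
  simp [tauVec, tauOp, mul_add]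

theorem tauVec_smul {b : (W⁄H).toAffine.FunctionField} (hb : twist W H b = b)
    (v : Fin n → (W⁄H).toAffine.FunctionField) : tauVec f n (b • v) = b • tauVec f n v := by
  ext i
  simp only [tauVec, tauOp, Pi.smul_apply, smul_eq_mul, map_mul, hb]
  ring

theorem tauVec_matAct (M : TwMatrix F H n) (v : Fin n → (W⁄H).toAffine.FunctionField) :
    tauVec f n (matAct M v) = matAct (twistMatrix F H n M) (tauVec f n v) := by
  ext i
  simp only [tauVec, tauOp, matAct, map_sum, twist_smul, Finset.mul_sum, mul_smul_comm]
  rfl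

theorem tauVec_iterate_add (k : ℕ) (v w : Fin n → (W⁄H).toAffine.FunctionField) :
    (tauVec f n)^[k] (v + w) = (tauVec f n)^[k] v + (tauVec f n)^[k] w := by
  induction k generalizing v w with
  | zero => rfl
  | succ k ih => rw [Function.iterate_succ_apply, tauVec_add, ih]; rfl

theorem tauVec_iterate_zero (k : ℕ) :
    (tauVec f n)^[k] (0 : Fin n → (W⁄H).toAffine.FunctionField) = 0 := by
  simpa using tauVec_iterate_add f k (0 : Fin n → (W⁄H).toAffine.FunctionField) 0

theorem tauVec_iterate_smul {b : (W⁄H).toAffine.FunctionField} (hb : twist W H b = b) (k : ℕ)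
    (v : Fin n → (W⁄H).toAffine.FunctionField) :
    (tauVec f n)^[k] (b • v) = b • (tauVec f n)^[k] v := by
  induction k generalizing v with
  | zero => rfl
  | succ k ih => rw [Function.iterate_succ_apply, tauVec_smul f hb, ih]; rfl

theorem tauVec_iterate_matAct (k : ℕ) (M : TwMatrix F H n)
    (v : Fin n → (W⁄H).toAffine.FunctionField) :
    (tauVec f n)^[k] (matAct M v)
      = matAct (SkewPolynomial.φ^[k] M : TwMatrix F H n) ((tauVec f n)^[k] v) := by
  induction k generalizing v M with
  | zero => rfl
  | succ k ih => rw [Function.iterate_succ_apply, tauVec_matAct, ih]; rfl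

variable (v : Fin n → (W⁄H).toAffine.FunctionField)

/-- The action of a twisted polynomial on a column vector. -/
def twEval (p : TwPoly F H n) : Fin n → (W⁄H).toAffine.FunctionField :=
  p.sum fun k M => matAct M ((tauVec f n)^[k] v)

theorem twEval_zero : twEval f v (0 : TwPoly F H n) = 0 :=
  SkewPolynomial.sum_zero_index _

theorem twEval_add (p q : TwPoly F H n) : twEval f v (p + q) = twEval f v p + twEval f v q :=
  SkewPolynomial.sum_add_index p q _ (fun _ => matAct_zero_left _)
    fun _ _ _ => matAct_add_left _ _ _

theorem twEval_monomial (k : ℕ) (M : TwMatrix F H n) :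
    twEval f v (SkewPolynomial.monomial k M) = matAct M ((tauVec f n)^[k] v) :=
  SkewPolynomial.sum_monomial_index (matAct_zero_left _)

theorem twEval_monomial_mul (k : ℕ) (M : TwMatrix F H n) (p : TwPoly F H n) :
    twEval f v (SkewPolynomial.monomial k M * p)
      = matAct M ((tauVec f n)^[k] (twEval f v p)) := by
  induction p using SkewPolynomial.induction with
  | h0 =>
    rw [mul_zero, twEval_zero, tauVec_iterate_zero]
    ext i
    simp [matAct]
  | ha l N q _ _ ih =>
    rw [mul_add, twEval_add, ih, SkewPolynomial.monomial_mul_monomial, twEval_monomial,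
      twEval_add, twEval_monomial, tauVec_iterate_add, matAct_add_right, tauVec_iterate_matAct,
      ← Function.iterate_add_apply]
    congr 1
    exact matAct_mul _ _ _

/-- Multiplication by a twist-invariant function commutes with both matrices and `τ`. This lets
composition of operators on `v` become multiplication of functions. -/
theorem twEval_mul {p : TwPoly F H n} {b : (W⁄H).toAffine.FunctionField} (hb : twist W H b = b)
    (hp : twEval f v p = b • v) (q : TwPoly F H n) : twEval f v (q * p) = b • twEval f v q := by
  induction q using SkewPolynomial.induction with
  | h0 => rw [zero_mul, twEval_zero, smul_zero]
  | ha k M q _ _ ih =>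
    rw [add_mul, twEval_add, ih, twEval_monomial_mul, hp, tauVec_iterate_smul f hb, matAct_smul,
      twEval_add, twEval_monomial, smul_add]

theorem twEval_algebraMap (c : F) :
    twEval f v (algebraMap F (TwPoly F H n) c)
      = (const (algebraMap F H c) : (W⁄H).toAffine.FunctionField) • v := by
  refine (twEval_monomial f v 0 (algebraMap F (TwMatrix F H n) c)).trans ?_
  ext i
  rw [Pi.smul_apply, smul_eq_mul, const_mul]
  refine (Finset.sum_eq_single i (fun j _ hj => ?_) (by simp)).trans ?_
  · change (algebraMap F (Matrix (Fin n) (Fin n) H) c i j) • _ = _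
    rw [Matrix.algebraMap_matrix_apply, if_neg hj.symm, zero_smul]
  · change (algebraMap F (Matrix (Fin n) (Fin n) H) c i i) • _ = _
    rw [Matrix.algebraMap_matrix_apply, if_pos rfl]
    rfl

theorem tauVec_iterate_apply (g : Fin n → (W⁄H).toAffine.FunctionField) (k : ℕ) (j : Fin n) :
    (tauVec f n)^[k] g j = gExt f g (j + k * n) := by
  induction k with
  | zero => simp [gExt_of_lt]
  | succ k ih =>
    rw [Function.iterate_succ_apply', tauVec, ih, add_one_mul, ← add_assoc, gExt_add f j.pos]

/-- Row `i` of the value on `g` is a combination of the independent functions with index `j + kn`,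
whose coefficients are the entries `(i, j)` of the coefficients of `τ^k`. Division with remainder by
`n` shows that no function occurs twice. -/
theorem twEval_injective {g : Fin n → (W⁄H).toAffine.FunctionField}
    (hg : LinearIndependent H (gExt f g)) {p q : TwPoly F H n}
    (h : twEval f g p = twEval f g q) : p = q := by
  have key (r : TwPoly F H n) (hr : twEval f g r = 0) : r = 0 := by
    let idx : ℕ × Fin n → ℕ := fun x => x.2 + x.1 * n
    have hidx : Function.Injective idx := by
      rintro ⟨k, j⟩ ⟨l, i⟩ hkl
      have hdiv := congrArg (· / n) hkl
      have hmod := congrArg (· % n) hkl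
      simp only [idx, Nat.add_mul_mod_self_right, Nat.mod_eq_of_lt j.2, Nat.mod_eq_of_lt i.2]
        at hmod
      simp only [idx, Nat.add_mul_div_right _ _ j.pos, Nat.div_eq_of_lt j.2,
        Nat.div_eq_of_lt i.2, zero_add] at hdiv
      exact Prod.ext hdiv (Fin.ext hmod)
    have hli := linearIndependent_iff'.mp (hg.comp idx hidx)
    ext k
    apply Matrix.ext
    intro i j
    by_cases hk : k ∈ r.support
    · refine hli (r.support ×ˢ Finset.univ)
        (fun x => (r.coeff x.1 : Matrix (Fin n) (Fin n) H) i x.2) ?_ (k, j) (by simp [hk])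
      rw [Finset.sum_product]
      have := congrFun hr i
      rw [twEval, SkewPolynomial.sum_def, Finset.sum_apply] at this
      refine Eq.trans (Finset.sum_congr rfl fun k _ => Finset.sum_congr rfl fun j _ => ?_) this
      rw [tauVec_iterate_apply]
      rfl
    · rw [SkewPolynomial.notMem_support_iff.mp hk]
      rfl
  rw [← sub_eq_zero]
  apply key
  have := twEval_add f g (p - q) q
  rwa [sub_add_cancel, h, right_eq_add] at this

end Action

/-! ### Construction of the homomorphism `ρ` -/

section Existence

variable {F : Type*} [Field F] [Fintype F] {W : WeierstrassCurve.Affine F} {H : Type*} [Field H]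
  [Algebra F H] {n : ℕ}

theorem exists_algHom_of_twEval {f : (W⁄H).toAffine.FunctionField}
    {g : Fin n → (W⁄H).toAffine.FunctionField} (hg : LinearIndependent H (gExt f g))
    {pt py : TwPoly F H n} (ht : twEval f g pt
      = (regular (tCoord _) : (W⁄H).toAffine.FunctionField) • g)
    (hy : twEval f g py
      = (regular (yCoord _) : (W⁄H).toAffine.FunctionField) • g) :
    ∃! ρ : W.CoordinateRing →ₐ[F] TwPoly F H n, ρ (tCoord W) = pt ∧ ρ (yCoord W) = py := by
  have hex (a : W.CoordinateRing) : ∃ p : TwPoly F H n, twEval f g p = scalarExt W H a • g := by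
    have h : a ∈ Algebra.adjoin F {tCoord W, yCoord W} := by
      rw [adjoin_tCoord_yCoord]; trivial
    induction h using Algebra.adjoin_induction with
    | mem x hx =>
      rcases hx with rfl | rfl
      · exact ⟨pt, by rw [scalarExt_tCoord, ht]⟩
      · exact ⟨py, by rw [scalarExt_yCoord, hy]⟩
    | algebraMap c => exact ⟨algebraMap F _ c, by rw [scalarExt_algebraMap, twEval_algebraMap]⟩
    | add x y _ _ hx hy =>
      obtain ⟨p, hp⟩ := hx
      obtain ⟨q, hq⟩ := hy
      exact ⟨p + q, by rw [twEval_add, hp, hq, map_add, add_smul]⟩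
    | mul x y _ _ hx hy =>
      obtain ⟨p, hp⟩ := hx
      obtain ⟨q, hq⟩ := hy
      exact ⟨p * q, by
        rw [twEval_mul f g (twist_scalarExt W H y) hq, hp, smul_smul, ← map_mul, mul_comm]⟩
  -- The choice is in fact unique by `twEval_injective`, so each homomorphism law below is checked
  -- on the vector `g`.
  choose ρ hρ using hex
  have hone : ρ 1 = 1 := twEval_injective f hg (by
    rw [hρ, map_one, ← map_one (algebraMap F (TwPoly F H n)), twEval_algebraMap, map_one]
    simp)
  refine ⟨{
    toFun := ρ
    map_one' := hone
    map_mul' := fun a b => twEval_injective f hg (by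
      rw [twEval_mul f g (twist_scalarExt W H b) (hρ b), hρ, hρ, smul_smul, ← map_mul, mul_comm])
    map_zero' := twEval_injective f hg (by rw [hρ, map_zero, zero_smul, twEval_zero])
    map_add' := fun a b => twEval_injective f hg (by
      rw [twEval_add, hρ, hρ, hρ, map_add, add_smul])
    commutes' := fun c => twEval_injective f hg (by
      rw [hρ, scalarExt_algebraMap, twEval_algebraMap]) },
    ⟨twEval_injective f hg ((hρ _).trans (by rw [scalarExt_tCoord, ht])),
      twEval_injective f hg ((hρ _).trans (by rw [scalarExt_yCoord, hy]))⟩, ?_⟩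
  rintro ρ' ⟨ht', hy'⟩
  refine AlgHom.ext_of_adjoin_eq_top (adjoin_tCoord_yCoord W) ?_
  rintro x (rfl | rfl)
  · exact ht'.trans (twEval_injective f hg ((hρ _).trans (by rw [scalarExt_tCoord, ht]))).symm
  · exact hy'.trans (twEval_injective f hg ((hρ _).trans (by rw [scalarExt_yCoord, hy]))).symm

/-- The coefficients of `τ⁰`, `τ¹`, `τ²` see consecutive windows of `n` indices. For `n ≥ 2` the
three windows contain every index up to `i + 3`. -/
theorem sum_blocks {M : Type*} [AddCommMonoid M] (n : ℕ) (c : ℕ → M) :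
    ∑ j : Fin n, c j + ∑ j : Fin n, c (j + n) + ∑ j : Fin n, c (j + 2 * n)
      = ∑ m ∈ Finset.range (3 * n), c m := by
  rw [show 3 * n = n + n + n by ring, Finset.sum_range_add, Finset.sum_range_add,
    Fin.sum_univ_eq_sum_range, Fin.sum_univ_eq_sum_range (fun j => c (j + n)),
    Fin.sum_univ_eq_sum_range (fun j => c (j + 2 * n))]
  simp only [add_comm, two_mul]

variable [Algebra W.FunctionField H]
  {f : (W⁄H).toAffine.FunctionField} {g : Fin n → (W⁄H).toAffine.FunctionField} {a y z : Fin n → H}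

theorem twEval_rhoT (hn : 2 ≤ n) (h : AreStructureConstants f g a y z) :
    twEval f g (rhoT F (thetaElt W H) a)
      = (regular (tCoord _) : (W⁄H).toAffine.FunctionField) • g := by
  rw [rhoT, twEval_add, ← SkewPolynomial.monomial_zero_left, SkewPolynomial.C_mul_X_eq_monomial,
    twEval_monomial, twEval_monomial]
  ext i
  have hi := (h i).1
  simp only [const_mul] at hi
  rw [Pi.smul_apply, smul_eq_mul, ← gExt_of_lt f g i, hi]
  -- Row `i` of all coefficient matrices, laid side by side, forms one sequence; `dTheta` and
  -- `eTheta` are its first two windows of length `n`.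
  let c : ℕ → H := fun m => if m = i then thetaElt W H else if m = i + 1 then a i
    else if m = i + 2 then 1 else 0
  have h1 : matAct (dTheta F (thetaElt W H) a) ((tauVec f n)^[0] g) i
      = ∑ j : Fin n, c j • gExt f g j :=
    Finset.sum_congr rfl fun j _ => by rw [tauVec_iterate_apply, zero_mul, add_zero]; rfl
  have h2 : matAct (eTheta F a) ((tauVec f n)^[1] g) i
      = ∑ j : Fin n, c (j + n) • gExt f g (j + n) := by
    refine Finset.sum_congr rfl fun j _ => ?_
    rw [tauVec_iterate_apply, one_mul]
    congr 1
    change _ = if _ then _ else _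
    rw [if_neg (by omega)]
    rfl
  have h3 : ∑ j : Fin n, c (j + 2 * n) • gExt f g (j + 2 * n) = 0 := by
    refine Finset.sum_eq_zero fun j _ => ?_
    simp only [c]
    rw [if_neg (by omega), if_neg (by omega), if_neg (by omega), zero_smul]
  rw [Pi.add_apply, h1, h2, ← add_zero (_ + _), ← h3, sum_blocks n fun m => c m • gExt f g m]
  have hc (m : ℕ) : c m • gExt f g m = (if m = i then thetaElt W H • gExt f g i else 0)
      + (if m = i + 1 then a i • gExt f g (i + 1) else 0)
      + (if m = i + 2 then gExt f g (i + 2) else 0) := by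
    simp only [c]
    split_ifs <;> first | omega | simp_all
  simp only [hc, Finset.sum_add_distrib, Finset.sum_ite_eq', Finset.mem_range]
  rw [if_pos (by omega), if_pos (by omega), if_pos (by omega)]

theorem twEval_rhoY (hn : 2 ≤ n) (h : AreStructureConstants f g a y z) :
    twEval f g (rhoY F (etaElt W H) y z)
      = (regular (yCoord _) : (W⁄H).toAffine.FunctionField) • g := by
  rw [rhoY, twEval_add, twEval_add, ← SkewPolynomial.monomial_zero_left,
    SkewPolynomial.C_mul_X_eq_monomial, SkewPolynomial.C_mul_X_pow_eq_monomial,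
    twEval_monomial, twEval_monomial, twEval_monomial]
  ext i
  have hi := (h i).2
  simp only [const_mul] at hi
  rw [Pi.smul_apply, smul_eq_mul, ← gExt_of_lt f g i, hi]
  let c : ℕ → H := fun m => if m = i then etaElt W H else if m = i + 1 then y i
    else if m = i + 2 then z i else if m = i + 3 then 1 else 0
  have h1 : matAct (dEta F (etaElt W H) y z) ((tauVec f n)^[0] g) i
      = ∑ j : Fin n, c j • gExt f g j :=
    Finset.sum_congr rfl fun j _ => by rw [tauVec_iterate_apply, zero_mul, add_zero]; rfl
  have h2 : matAct (eEta F y z) ((tauVec f n)^[1] g) i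
      = ∑ j : Fin n, c (j + n) • gExt f g (j + n) := by
    refine Finset.sum_congr rfl fun j _ => ?_
    rw [tauVec_iterate_apply, one_mul]
    congr 1
    change _ = if _ then _ else _
    rw [if_neg (by omega)]
    rfl
  have h3 : matAct (eEtaTwo F) ((tauVec f n)^[2] g) i
      = ∑ j : Fin n, c (j + 2 * n) • gExt f g (j + 2 * n) := by
    refine Finset.sum_congr rfl fun j _ => ?_
    rw [tauVec_iterate_apply]
    congr 1
    have hc : c (j + 2 * n) = if (j : ℕ) + 2 * n = i + 3 then 1 else 0 := by
      simp only [c]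
      rw [if_neg (by omega), if_neg (by omega), if_neg (by omega)]
    rw [hc]
    -- Since `i < n` and `n ≥ 2`, the equation `j + 2n = i + 3` holds only for `n = 2`, `i = 1`, `j
    -- = 0`.
    exact if_congr (by omega) rfl rfl
  rw [Pi.add_apply, Pi.add_apply, h1, h2, h3, sum_blocks n fun m => c m • gExt f g m]
  have hc (m : ℕ) : c m • gExt f g m = (if m = i then etaElt W H • gExt f g i else 0)
      + (if m = i + 1 then y i • gExt f g (i + 1) else 0)
      + (if m = i + 2 then z i • gExt f g (i + 2) else 0)
      + (if m = i + 3 then gExt f g (i + 3) else 0) := by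
    simp only [c]
    split_ifs <;> first | omega | simp_all
  simp only [hc, Finset.sum_add_distrib, Finset.sum_ite_eq', Finset.mem_range]
  rw [if_pos (by omega), if_pos (by omega), if_pos (by omega), if_pos (by omega)]

end Existence

/-! ### Triangular matrices with constant diagonal -/

section Triangular

variable {H : Type*} [Field H] {n : ℕ}

/-- The matrix `M` is upper triangular with all diagonal entries equal to `c`. -/
def IsTriangularWithDiag (M : Matrix (Fin n) (Fin n) H) (c : H) : Prop :=
  M.BlockTriangular id ∧ ∀ i, M i i = c

theorem IsTriangularWithDiag.add {M N : Matrix (Fin n) (Fin n) H} {c d : H}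
    (hM : IsTriangularWithDiag M c) (hN : IsTriangularWithDiag N d) :
    IsTriangularWithDiag (M + N) (c + d) :=
  ⟨hM.1.add hN.1, fun i => by rw [Matrix.add_apply, hM.2, hN.2]⟩

theorem IsTriangularWithDiag.mul {M N : Matrix (Fin n) (Fin n) H} {c d : H}
    (hM : IsTriangularWithDiag M c) (hN : IsTriangularWithDiag N d) :
    IsTriangularWithDiag (M * N) (c * d) := by
  refine ⟨hM.1.mul hN.1, fun i => ?_⟩
  rw [Matrix.mul_apply, Finset.sum_eq_single i, hM.2, hN.2]
  · intro j _ hj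
    rcases lt_or_gt_of_ne hj with h | h
    · rw [hM.1 h, zero_mul]
    · rw [hN.1 h, mul_zero]
  · simp

theorem isTriangularWithDiag_algebraMap (c : H) :
    IsTriangularWithDiag (algebraMap H (Matrix (Fin n) (Fin n) H) c) c := by
  refine ⟨fun i j hij => ?_, fun i => ?_⟩
  · have h : j < i := hij
    rw [Matrix.algebraMap_matrix_apply, if_neg h.ne']
  · rw [Matrix.algebraMap_matrix_apply, if_pos rfl]
    rfl

/-- After subtracting the scalar the characteristic polynomial is `X^n`, so Cayley-Hamilton applies.
-/
theorem IsTriangularWithDiag.isNilpotent {M : Matrix (Fin n) (Fin n) H} {c : H}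
    (hM : IsTriangularWithDiag M c) : IsNilpotent (M - algebraMap H _ c) := by
  have h0 : IsTriangularWithDiag (M - algebraMap H (Matrix (Fin n) (Fin n) H) c) 0 := by
    have := hM.add (isTriangularWithDiag_algebraMap (n := n) (-c))
    rwa [map_neg, ← sub_eq_add_neg, add_neg_cancel] at this
  refine ⟨n, ?_⟩
  have hc := Matrix.charpoly_of_isUpperTriangular _ h0.1
  simp only [h0.2, C_0, sub_zero, Finset.prod_const, Finset.card_univ, Fintype.card_fin] at hc
  have := Matrix.aeval_self_charpoly (M - algebraMap H (Matrix (Fin n) (Fin n) H) c)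
  rwa [hc, aeval_X_pow] at this

theorem isTriangularWithDiag_dTheta (F : Type*) (θ : H) (a : Fin n → H) :
    IsTriangularWithDiag (dTheta F θ a) θ := by
  refine ⟨fun i j hij => ?_, fun i => if_pos rfl⟩
  have hij' : (j : ℕ) < i := hij
  change (if _ then _ else _ : H) = 0
  rw [if_neg (by omega), if_neg (by omega), if_neg (by omega)]

theorem isTriangularWithDiag_dEta (F : Type*) (η : H) (y z : Fin n → H) :
    IsTriangularWithDiag (dEta F η y z) η := by
  refine ⟨fun i j hij => ?_, fun i => if_pos rfl⟩
  have hij' : (j : ℕ) < i := hij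
  change (if _ then _ else _ : H) = 0
  rw [if_neg (by omega), if_neg (by omega), if_neg (by omega), if_neg (by omega)]

end Triangular

/-! ### The constant coefficient of `ρ` and the Anderson module property -/

section Nilpotence

variable {F : Type*} [Field F] [Fintype F] {H : Type*} [Field H] [Algebra F H] {n : ℕ}

theorem coeff_zero_mul (p q : TwPoly F H n) :
    (p * q).coeff 0 = p.coeff 0 * q.coeff 0 := by
  induction p using SkewPolynomial.induction with
  | h0 => simp
  | ha k M p _ _ ih =>
    rw [add_mul, SkewPolynomial.coeff_add, ih, SkewPolynomial.coeff_add, add_mul]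
    congr 1
    clear ih
    induction q using SkewPolynomial.induction with
    | h0 => simp
    | ha l N q _ _ ih =>
      rw [mul_add, SkewPolynomial.coeff_add, ih, SkewPolynomial.coeff_add, mul_add,
        SkewPolynomial.monomial_mul_monomial, SkewPolynomial.coeff_monomial,
        SkewPolynomial.coeff_monomial, SkewPolynomial.coeff_monomial]
      congr 1
      rcases k with _ | k
      · rcases l with _ | l <;> simp
      · simp

theorem coeff_zero_rhoT (θ : H) (a : Fin n → H) : (rhoT F θ a).coeff 0 = dTheta F θ a := by
  rw [rhoT, SkewPolynomial.coeff_add, SkewPolynomial.C_mul_X_eq_monomial]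
  simp

theorem coeff_zero_rhoY (η : H) (y z : Fin n → H) : (rhoY F η y z).coeff 0 = dEta F η y z := by
  rw [rhoY, SkewPolynomial.coeff_add, SkewPolynomial.coeff_add, SkewPolynomial.C_mul_X_eq_monomial,
    SkewPolynomial.C_mul_X_pow_eq_monomial]
  simp

variable {W : WeierstrassCurve.Affine F} [Algebra W.FunctionField H]
  [IsScalarTower F W.FunctionField H]

/-- Triangularity with diagonal `ι(b)` is stable under sums and products, whereas nilpotence of the
difference alone need not be. It therefore passes from `t` and `y` to the whole ring. -/
theorem isAndersonModule_of_eq {ρ : W.CoordinateRing →ₐ[F] TwPoly F H n} {a y z : Fin n → H}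
    (ht : ρ (tCoord W) = rhoT F (thetaElt W H) a)
    (hy : ρ (yCoord W) = rhoY F (etaElt W H) y z) : IsAndersonModule ρ := by
  have key (b : W.CoordinateRing) : IsTriangularWithDiag ((ρ b).coeff 0) (iota W H b) := by
    have h : b ∈ Algebra.adjoin F {tCoord W, yCoord W} := by
      rw [adjoin_tCoord_yCoord]; trivial
    induction h using Algebra.adjoin_induction with
    | mem x hx =>
      rcases hx with rfl | rfl
      · rw [ht, coeff_zero_rhoT]
        exact isTriangularWithDiag_dTheta F _ _
      · rw [hy, coeff_zero_rhoY]
        exact isTriangularWithDiag_dEta F _ _ _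
    | algebraMap c =>
      rw [AlgHom.commutes, iota_algebraMap]
      have h : (algebraMap F (TwPoly F H n) c).coeff 0 = algebraMap F (TwMatrix F H n) c :=
        SkewPolynomial.coeff_C_zero
      rw [h]
      exact isTriangularWithDiag_algebraMap (algebraMap F H c)
    | add x y _ _ hx hy =>
      rw [map_add, map_add, SkewPolynomial.coeff_add]
      exact hx.add hy
    | mul x y _ _ hx hy =>
      rw [map_mul, map_mul, coeff_zero_mul]
      exact hx.mul hy
  exact fun b => (key b).isNilpotent

end Nilpotence

end

end AndersonTensor

theorem propositionP {F : Type*} [Field F] [Fintype F] (W : WeierstrassCurve.Affine F)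
    [W.IsElliptic] {H : Type*} [Field H] [DecidableEq H] [Algebra F H]
    [Algebra W.FunctionField H] [IsScalarTower F W.FunctionField H]
    (V : WeierstrassCurve.Affine.Point (W⁄H)) (hV : V - frobPoint V = Xi W H)
    (n : ℕ) (hn : 2 ≤ n)
    (hVn : ∀ j : ℕ, 0 < j → j < n → j • frobPoint V + (n - j) • V ≠ 0) :
    (∃! f : (W⁄H).toAffine.FunctionField, IsShtukaFunction V f) ∧
    (∃! g : Fin n → (W⁄H).toAffine.FunctionField, IsTauBasis V n g) ∧
    ∀ (f : (W⁄H).toAffine.FunctionField)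
      (g : Fin n → (W⁄H).toAffine.FunctionField),
      IsShtukaFunction V f → IsTauBasis V n g →
      (∃! c : (Fin n → H) × (Fin n → H) × (Fin n → H),
        AreStructureConstants f g c.1 c.2.1 c.2.2) ∧
      ∀ a y z : Fin n → H, AreStructureConstants f g a y z →
        (∃! ρ : W.CoordinateRing →ₐ[F] TwPoly F H n,
          ρ (tCoord W) = rhoT F (thetaElt W H) a ∧ ρ (yCoord W) = rhoY F (etaElt W H) y z) ∧
        ∀ ρ : W.CoordinateRing →ₐ[F] TwPoly F H n,
          ρ (tCoord W) = rhoT F (thetaElt W H) a → ρ (yCoord W) = rhoY F (etaElt W H) y z →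
          IsAndersonModule ρ := by
  have hn0 : 0 < n := by omega
  refine ⟨existsUnique_shtuka hV, existsUnique_tauBasis hV hVn, fun f g hf hg =>
    ⟨existsUnique_structureConstants hV hVn hn0 hf hg, fun a y z h => ⟨?_, ?_⟩⟩⟩
  · exact exists_algHom_of_twEval (linearIndependent_gExt hV hVn hn0 hf hg)
      (twEval_rhoT hn h) (twEval_rhoY hn h)
  · exact fun ρ => isAndersonModule_of_eq
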